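/- \textbf{Proposition (equivariant holonomy and quotient, case $\mu^{\Xi}=0$).} Let $G$ be a Lie group with Lie algebra $\mathfrak g$, let $p\colon P\to M$ be a smooth principal $U(1)$-bundle, and let $G$ act on the left on $P$ and on $M$ so that $p$ is $G$-equivariant and the action on $P$ commutes with that of $U(1)$; write $\phi_P$, $\phi_M$ for the actions of $\phi\in G$. Assume that these actions are free and that $P/G$ and $M/G$ are smooth manifolds for which the quotient maps $\bar q_G\colon P\to P/G$ and $q_G\colon M\to M/G$ are (left) smooth principal $G$-bundles. Let $\Xi\in\Omega^1(P,i\mathbb R)$ be a $G$-invariant connection form on $P\to M$, normalized by $\Xi\bigl(\tfrac{d}{dt}|_{t=0}\,y\cdot e^{it}\bigr)=i$ for $y\in P$. Its momentum is given, for $X\in\mathfrak g$, by the function $\mu^{\Xi}_X\colon M\to\mathbb R$ with $\mu^{\Xi}_X\circ p=-\tfrac{i}{2\pi}\,\Xi(X_P)$, where $X_P(y)=\tfrac{d}{dt}|_{t=0}\exp(-tX)_P(y)$. A curve is a piecewise $C^1$ map $\gamma\colon[0,1]\to M$. A $\Xi$-horizontal lift of $\gamma$ is a piecewise $C^1$ curve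 $\overline\gamma\colon[0,1]\to P$ with $p\circ\overline\gamma=\gamma$ and $\Xi(\dot{\overline\gamma})=0$. For $\phi\in G$ let $\mathcal C^{\phi}(M)$ be the set of curves $\gamma$ in $M$ with $\gamma(1)=\phi_M(\gamma(0))$. For $\gamma\in\mathcal C^{\phi}(M)$ the $\phi$-equivariant holonomy $\mathrm{Hol}^{\Xi}_{\phi}(\gamma)\in U(1)$ is characterized by $\overline\gamma^{\,y}(1)=\phi_P(y)\cdot\mathrm{Hol}^{\Xi}_{\phi}(\gamma)$ for every $y\in p^{-1}(\gamma(0))$, where $\overline\gamma^{\,y}$ is the $\Xi$-horizontal lift of $\gamma$ starting at $y$. For a connection on a principal $U(1)$-bundle and a loop $\gamma$ in the base, the ordinary holonomy $\mathrm{Hol}(\gamma)\in U(1)$ is characterized by $\overline\gamma^{\,y}(1)=y\cdot\mathrm{Hol}(\gamma)$. Suppose that $\mu^{\Xi}=0$, i.e. $\mu^{\Xi}_X=0$ for all $X\in\mathfrak g$. Then the induced map $P/G\to M/G$, with the induced action of $U(1)$, is a smooth principal $U(1)$-bundle, and $\Xi$ projects onto a connection on it: there is a unique $1$-form $\underline\Xi$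 on $P/G$ with $\bar q_G^{\,*}\underline\Xi=\Xi$, and $\underline\Xi\in\Omega^1(P/G,i\mathbb R)$ is a connection form on $P/G\to M/G$. Moreover, for every $\phi\in G$ and every $\gamma\in\mathcal C^{\phi}(M)$, the curve $\underline\gamma=q_G\circ\gamma$ is a loop on $M/G$ (piecewise $C^1$, with $\underline\gamma(1)=\underline\gamma(0)$), the holonomies $\mathrm{Hol}^{\Xi}_{\phi}(\gamma)$ and $\mathrm{Hol}^{\underline\Xi}(\underline\gamma)$ are well defined, and $$\mathrm{Hol}^{\Xi}_{\phi}(\gamma)=\mathrm{Hol}^{\underline\Xi}(\underline\gamma).$$ -/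

import Mathlib

open Set MulAction
open scoped Manifold ContDiff

noncomputable section

section PrincipalBundles

variable {EK : Type*} [NormedAddCommGroup EK] [NormedSpace ℝ EK]
  {HK : Type*} [TopologicalSpace HK] (IK : ModelWithCorners ℝ EK HK)
  {EP : Type*} [NormedAddCommGroup EP] [NormedSpace ℝ EP]
  {HP : Type*} [TopologicalSpace HP] (IP : ModelWithCorners ℝ EP HP)
  {EB : Type*} [NormedAddCommGroup EB] [NormedSpace ℝ EB]
  {HB : Type*} [TopologicalSpace HB] (IB : ModelWithCorners ℝ EB HB)

/-- `π : P → B` is a smooth (left) principal `K`-bundle: `K` acts smoothly on `P`, and around every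
point of `B` there is a smooth local trivialization `π ⁻¹' U ≃ U × K` over `U` which turns the
action of `K` into multiplication of the second factor by `K` on the left.  (This forces the action
to be free, and its orbits to be the fibres of `π`.)  For an abelian group such as `U(1)`, left and
right actions are the same thing, and `y · u` is written `u • y`. -/
structure IsPrincipalBundle (K : Type*) [Group K] [TopologicalSpace K] [ChartedSpace HK K]
    {P : Type*} [TopologicalSpace P] [ChartedSpace HP P]
    {B : Type*} [TopologicalSpace B] [ChartedSpace HB B]
    [MulAction K P] (π : P → B) : Prop where
  smooth_smul : ContMDiff (IK.prod IP) IP ∞ (fun x : K × P => x.1 • x.2)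
  exists_trivialization : ∀ b : B, ∃ e : Bundle.Trivialization K π, b ∈ e.baseSet ∧
    ContMDiffOn IP (IB.prod IK) ∞ e e.source ∧
    ContMDiffOn (IB.prod IK) IP ∞ e.toOpenPartialHomeomorph.symm e.target ∧
    ∀ (k : K) (y : P), π y ∈ e.baseSet → π (k • y) = π y ∧ (e (k • y)).2 = k * (e y).2

end PrincipalBundles

section Quotients

/-- An action commuting with that of `G` descends to the quotient by `G`. -/
instance quotientMulAction (G K P : Type*) [Group G] [Group K] [MulAction G P] [MulAction K P]
    [SMulCommClass G K P] : MulAction K (orbitRel.Quotient G P) where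
  smul k := Quotient.map (fun y => k • y) (by
    rintro _ y ⟨g, rfl⟩
    exact ⟨g, smul_comm g k y⟩)
  one_smul := by
    rintro ⟨y⟩
    exact congrArg (Quotient.mk (orbitRel G P)) (one_smul K y)
  mul_smul k l := by
    rintro ⟨y⟩
    exact congrArg (Quotient.mk (orbitRel G P)) (mul_smul k l y)

/-- The quotient map `q_G : X → X/G`. -/
def quotientProj (G X : Type*) [Group G] [MulAction G X] : X → orbitRel.Quotient G X :=
  Quotient.mk (orbitRel G X)

/-- The map `P/G → M/G` induced by a `G`-equivariant map `p : P → M`. -/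
def quotientMap {G P M : Type*} [Group G] [MulAction G P] [MulAction G M] (p : P → M)
    (hp : ∀ (g : G) (y : P), p (g • y) = g • p y) :
    orbitRel.Quotient G P → orbitRel.Quotient G M :=
  Quotient.map p (by
    rintro _ y ⟨g, rfl⟩
    exact ⟨g, (hp g y).symm⟩)

end Quotients

section Connections

variable {EP : Type*} [NormedAddCommGroup EP] [NormedSpace ℝ EP]
  {HP : Type*} [TopologicalSpace HP] (IP : ModelWithCorners ℝ EP HP)
  {P : Type*} [TopologicalSpace P] [ChartedSpace HP P]

variable (P) in
/-- Complex-valued differential `1`-forms on `P` (no regularity required). -/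
abbrev OneForm : Type _ := ∀ y : P, TangentSpace IP y →L[ℝ] ℂ

variable {IP}

/-- The form `Ξ` is invariant under the action of `K`: `k^* Ξ = Ξ` for every `k ∈ K`. -/
def IsInvariantForm (K : Type*) [Group K] [MulAction K P] (Ξ : OneForm IP P) : Prop :=
  ∀ (k : K) (y : P) (v : TangentSpace IP y),
    Ξ (k • y) (mfderiv IP IP (fun z : P => k • z) y v) = Ξ y v

/-- `Ξ` is a connection form on a principal `U(1)`-bundle with total space `P`: it is a smooth
`iℝ`-valued `1`-form, it is `U(1)`-invariant, and it maps the vector field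
`y ↦ d/dt|₀ y · exp(it)` generating the action of `U(1)` to `i`. -/
structure IsConnectionForm [IsManifold IP 1 P] [MulAction Circle P] (Ξ : OneForm IP P) : Prop where
  smooth : ContMDiff IP.tangent 𝓘(ℝ, ℂ) ∞ (fun v : TangentBundle IP P => Ξ v.proj v.snd)
  imaginary : ∀ (y : P) (v : TangentSpace IP y), (Ξ y v).re = 0
  invariant : IsInvariantForm Circle Ξ
  vertical : ∀ y : P,
    Ξ _ (mfderiv 𝓘(ℝ, ℝ) IP (fun t : ℝ => Circle.exp t • y) 0 (1 : ℝ)) = Complex.I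

variable {EG : Type*} [NormedAddCommGroup EG] [NormedSpace ℝ EG]
  {HG : Type*} [TopologicalSpace HG] (IG : ModelWithCorners ℝ EG HG)
  {G : Type*} [Group G] [TopologicalSpace G] [ChartedSpace HG G] [MulAction G P]

variable (IP) in
/-- The fundamental vector field `X_P(y) = d/dt|₀ exp(-tX) • y` of an element `X` of the Lie algebra
of `G`, i.e. the derivative of `g ↦ g⁻¹ • y` at the identity in the direction `X`. -/
def fundamentalField (X : GroupLieAlgebra IG G) (y : P) : TangentSpace IP ((1 : G)⁻¹ • y) :=
  mfderiv IG IP (fun g : G => g⁻¹ • y) 1 X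

/-- The momentum `μ_X = -(i/2π) Ξ(X_P)` of `Ξ`, as a function on `P`.  For an invariant connection
form on an equivariant `U(1)`-bundle `P → M` it is constant on the fibres, and is the pull-back to
`P` of the function on `M` denoted in the same way. -/
def momentum (Ξ : OneForm IP P) (X : GroupLieAlgebra IG G) (y : P) : ℂ :=
  -(Complex.I / (2 * Real.pi)) * Ξ _ (fundamentalField IP IG X y)

end Connections

section Curves

variable {EM : Type*} [NormedAddCommGroup EM] [NormedSpace ℝ EM]
  {HM : Type*} [TopologicalSpace HM] (IM : ModelWithCorners ℝ EM HM)
  {M : Type*} [TopologicalSpace M] [ChartedSpace HM M]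

/-- `γ : [0,1] → M` is piecewise `C¹`: there is a subdivision of `[0,1]` such that `γ` is `C¹` on
each of its closed intervals (in particular `γ` is continuous).  Curves are represented by maps
`ℝ → M`, whose values outside `[0,1]` play no role. -/
def IsPiecewiseC1 (γ : ℝ → M) : Prop :=
  ∃ (n : ℕ) (t : ℕ → ℝ), t 0 = 0 ∧ t n = 1 ∧ Monotone t ∧
    ∀ i < n, ContMDiffOn 𝓘(ℝ, ℝ) IM 1 γ (Icc (t i) (t (i + 1)))

variable (M) in
/-- The space `C(M)` of loops on `M`. -/
def loopSpace : Set (ℝ → M) := {γ | IsPiecewiseC1 IM γ ∧ γ 1 = γ 0}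

variable (M) in
/-- The space `C^φ(M)` of piecewise `C¹` curves `γ : [0,1] → M` with `γ(1) = φ_M(γ(0))`. -/
def twistedLoopSpace {G : Type*} [Group G] [MulAction G M] (φ : G) : Set (ℝ → M) :=
  {γ | IsPiecewiseC1 IM γ ∧ γ 1 = φ • γ 0}

end Curves

section Holonomy

variable {EP : Type*} [NormedAddCommGroup EP] [NormedSpace ℝ EP]
  {HP : Type*} [TopologicalSpace HP] {IP : ModelWithCorners ℝ EP HP}
  {P : Type*} [TopologicalSpace P] [ChartedSpace HP P] {M : Type*}

/-- `c` is a `Ξ`-horizontal lift to `P` of the curve `γ : [0,1] → M`. -/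
structure IsHorizontalLift (p : P → M) (Ξ : OneForm IP P) (γ : ℝ → M) (c : ℝ → P) : Prop where
  piecewiseC1 : IsPiecewiseC1 IP c
  lift : ∀ t ∈ Icc (0 : ℝ) 1, p (c t) = γ t
  horizontal : ∀ t ∈ Ioo (0 : ℝ) 1, MDifferentiableAt 𝓘(ℝ, ℝ) IP c t →
    Ξ (c t) (mfderiv 𝓘(ℝ, ℝ) IP c t (1 : ℝ)) = 0

variable [MulAction Circle P]

/-- The property characterizing the holonomy `u = Hol^Ξ(γ)` of a loop `γ`: horizontal lifts `c` of
`γ` exist from every point of the fibre over `γ(0)`, and all of them satisfy `c(1) = c(0) · u`. -/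
def IsHolonomy (p : P → M) (Ξ : OneForm IP P) (γ : ℝ → M) (u : Circle) : Prop :=
  (∀ y : P, p y = γ 0 → ∃ c, IsHorizontalLift p Ξ γ c ∧ c 0 = y) ∧
    ∀ c, IsHorizontalLift p Ξ γ c → c 1 = u • c 0

/-- The holonomy `Hol^Ξ(γ)` of a loop `γ`. -/
def holonomy (p : P → M) (Ξ : OneForm IP P) (γ : ℝ → M) : Circle :=
  Classical.epsilon (IsHolonomy p Ξ γ)

variable {G : Type*} [Group G] [MulAction G P]

/-- The property characterizing the `φ`-equivariant holonomy `u = Hol_φ^Ξ(γ)`: horizontal lifts `c`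
of `γ` exist from every point of the fibre over `γ(0)`, and all of them satisfy
`c(1) = φ_P(c(0)) · u`. -/
def IsEquivariantHolonomy (p : P → M) (Ξ : OneForm IP P) (φ : G) (γ : ℝ → M) (u : Circle) : Prop :=
  (∀ y : P, p y = γ 0 → ∃ c, IsHorizontalLift p Ξ γ c ∧ c 0 = y) ∧
    ∀ c, IsHorizontalLift p Ξ γ c → c 1 = u • (φ • c 0)

/-- The `φ`-equivariant holonomy `Hol_φ^Ξ(γ)` of a curve `γ` with `γ(1) = φ_M(γ(0))`. -/
def equivariantHolonomy (p : P → M) (Ξ : OneForm IP P) (φ : G) (γ : ℝ → M) : Circle :=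
  Classical.epsilon (IsEquivariantHolonomy p Ξ φ γ)

end Holonomy

end

/-! Since the momentum vanishes, `Ξ` kills the directions of the `G`-orbits
(`OneForm.apply_orbit_eq_zero`). Being also `G`-invariant, it is basic for `P → P/G` and descends
(`IsInvariantForm.exists_descent`). The connection axioms for the descended form are checked after
pull-back to `P` (`IsConnectionForm.of_pullback`).

A horizontal lift `c` of `γ` projects to a horizontal lift of `q_G ∘ γ`. If `c 1 = u • φ • c 0`, the
projection forgets `φ` and leaves the relation that defines ordinary holonomy, with the same `u`.

This comparison of single lifts suffices because lifts exist from every point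
(`IsConnectionForm.exists_lift`) and two lifts differ by a constant of `U(1)`
(`IsConnectionForm.lift_unique`). Trivializations enter only through pairs of a local section and
the matching group-valued function, and `P/G → M/G` is shown to be principal by producing such
pairs. -/

/-! ### Local gauges of principal bundles -/

section Gauges

variable {EK : Type*} [NormedAddCommGroup EK] [NormedSpace ℝ EK]
  {HK : Type*} [TopologicalSpace HK] {IK : ModelWithCorners ℝ EK HK}
  {EP : Type*} [NormedAddCommGroup EP] [NormedSpace ℝ EP]
  {HP : Type*} [TopologicalSpace HP] {IP : ModelWithCorners ℝ EP HP}
  {EB : Type*} [NormedAddCommGroup EB] [NormedSpace ℝ EB]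
  {HB : Type*} [TopologicalSpace HB] {IB : ModelWithCorners ℝ EB HB}
  {K : Type*} [Group K] [TopologicalSpace K] [ChartedSpace HK K]
  {P : Type*} [TopologicalSpace P] [ChartedSpace HP P]
  {B : Type*} [TopologicalSpace B] [ChartedSpace HB B]
  [MulAction K P] {π : P → B}

variable (IK IP IB) in
/-- A local gauge over the open set `U`: a smooth section `s` together with the smooth equivariant
`K`-valued function `κ` on `π ⁻¹' U` that measures the position relative to `s`. -/
structure IsLocalGauge (π : P → B) (U : Set B) (s : B → P) (κ : P → K) : Prop where
  isOpen : IsOpen U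
  smooth_section : ContMDiffOn IB IP ∞ s U
  proj_section : ∀ x ∈ U, π (s x) = x
  smooth_gauge : ContMDiffOn IP IK ∞ κ (π ⁻¹' U)
  gauge_smul : ∀ (k : K) (y : P), π y ∈ U → κ (k • y) = k * κ y
  gauge_smul_section : ∀ y : P, π y ∈ U → κ y • s (π y) = y

namespace IsLocalGauge

variable {U : Set B} {s : B → P} {κ : P → K}

/-- Applying `κ` to `κ (s x) • s x = s x` shows that `κ (s x)` is idempotent in the group. -/
theorem gauge_section (h : IsLocalGauge IK IP IB π U s κ) {x : B} (hx : x ∈ U) : κ (s x) = 1 := by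
  have hs : π (s x) ∈ U := by rwa [h.proj_section x hx]
  have h1 := h.gauge_smul_section (s x) hs
  have h2 := h.gauge_smul (κ (s x)) (s x) hs
  rw [h.proj_section x hx] at h1
  rw [h1] at h2
  simpa using h2

theorem inv_gauge_smul (h : IsLocalGauge IK IP IB π U s κ) {y : P} (hy : π y ∈ U) :
    (κ y)⁻¹ • y = s (π y) :=
  inv_smul_eq_iff.2 (h.gauge_smul_section y hy).symm

end IsLocalGauge

namespace IsPrincipalBundle

theorem proj_smul (hπ : IsPrincipalBundle IK IP IB K π) (k : K) (y : P) : π (k • y) = π y := by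
  obtain ⟨e, he, -, -, h⟩ := hπ.exists_trivialization (π y)
  exact (h k y he).1

theorem contMDiff_proj (hπ : IsPrincipalBundle IK IP IB K π) : ContMDiff IP IB ∞ π := by
  intro y
  obtain ⟨e, he, h1, -, -⟩ := hπ.exists_trivialization (π y)
  have hy : y ∈ e.source := e.mem_source.2 he
  have h2 := contMDiffAt_fst.comp y (h1.contMDiffAt (e.open_source.mem_nhds hy))
  refine h2.congr_of_eventuallyEq ?_
  filter_upwards [e.open_source.mem_nhds hy] with z hz
  exact (e.coe_fst hz).symm

theorem exists_localGauge (hπ : IsPrincipalBundle IK IP IB K π) (b : B) :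
    ∃ (U : Set B) (s : B → P) (κ : P → K), b ∈ U ∧ IsLocalGauge IK IP IB π U s κ := by
  obtain ⟨e, he, h1, h2, h3⟩ := hπ.exists_trivialization b
  have hs : ∀ x ∈ e.baseSet, π (e.toOpenPartialHomeomorph.symm (x, 1)) = x :=
    fun x hx => e.proj_symm_apply' hx
  refine ⟨e.baseSet, fun x => e.toOpenPartialHomeomorph.symm (x, 1), fun y => (e y).2, he,
    e.open_baseSet, ?_, hs, ?_, fun k y hy => (h3 k y hy).2, ?_⟩
  · exact h2.comp (contMDiffOn_id.prodMk contMDiffOn_const) fun x hx => e.mem_target.2 hx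
  · rw [← e.source_eq]
    exact contMDiff_snd.comp_contMDiffOn h1
  · intro y hy
    have hs' := hs _ hy
    set z := e.toOpenPartialHomeomorph.symm (π y, 1) with hz
    have hzU : π z ∈ e.baseSet := by rwa [hs']
    have hez : e z = (π y, 1) := e.apply_symm_apply' hy
    obtain ⟨h4, h5⟩ := h3 (e y).2 z hzU
    refine e.injOn (e.mem_source.2 (by rwa [h4])) (e.mem_source.2 hy) ?_
    change e _ = e y
    refine Prod.ext ?_ ?_
    · rw [e.coe_fst (e.mem_source.2 (by rwa [h4])), e.coe_fst (e.mem_source.2 hy), h4, hs']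
    · rw [h5, hez, mul_one]

theorem surjective (hπ : IsPrincipalBundle IK IP IB K π) : Function.Surjective π := fun b => by
  obtain ⟨U, s, κ, hb, h⟩ := hπ.exists_localGauge b
  exact ⟨s b, h.proj_section b hb⟩

theorem smul_left_injective (hπ : IsPrincipalBundle IK IP IB K π) (y : P) :
    Function.Injective fun k : K => k • y := by
  obtain ⟨U, s, κ, hb, h⟩ := hπ.exists_localGauge (π y)
  intro k l hkl
  have := congrArg κ hkl
  simpa [h.gauge_smul _ _ hb] using this

/-- Inverse gauges carry both points to the same point of the local section. -/
theorem exists_smul_eq (hπ : IsPrincipalBundle IK IP IB K π) {y z : P} (hyz : π y = π z) :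
    ∃ k : K, k • y = z := by
  obtain ⟨U, s, κ, hb, h⟩ := hπ.exists_localGauge (π z)
  refine ⟨κ z * (κ y)⁻¹, ?_⟩
  rw [mul_smul, h.inv_gauge_smul (by rwa [hyz]), hyz, h.gauge_smul_section z hb]

/-- A function on the base is smooth if its pull-back to the total space is. -/
theorem contMDiffAt_of_comp {EN : Type*} [NormedAddCommGroup EN] [NormedSpace ℝ EN]
    {HN : Type*} [TopologicalSpace HN] {IN : ModelWithCorners ℝ EN HN}
    {N : Type*} [TopologicalSpace N] [ChartedSpace HN N]
    (hπ : IsPrincipalBundle IK IP IB K π) {f : B → N} {b : B}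
    (hf : ∀ y, π y = b → ContMDiffAt IP IN ∞ (f ∘ π) y) : ContMDiffAt IB IN ∞ f b := by
  obtain ⟨U, s, κ, hb, h⟩ := hπ.exists_localGauge b
  have hU := h.isOpen.mem_nhds hb
  refine ((hf (s b) (h.proj_section b hb)).comp b
    (h.smooth_section.contMDiffAt hU)).congr_of_eventuallyEq ?_
  filter_upwards [hU] with x hx
  simp [h.proj_section x hx]

/-- Converse of `exists_localGauge`: the trivialization is `y ↦ (π y, κ y)`, with inverse `(x, k) ↦
k • s x`. -/
theorem of_localGauges (hsmul : ContMDiff (IK.prod IP) IP ∞ (fun x : K × P => x.1 • x.2))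
    (hπ : ContMDiff IP IB ∞ π) (hπK : ∀ (k : K) (y : P), π (k • y) = π y)
    (hloc : ∀ b : B, ∃ (U : Set B) (s : B → P) (κ : P → K), b ∈ U ∧
      IsLocalGauge IK IP IB π U s κ) : IsPrincipalBundle IK IP IB K π where
  smooth_smul := hsmul
  exists_trivialization b := by
    obtain ⟨U, s, κ, hb, h⟩ := hloc b
    have h1 : ContMDiffOn IP (IB.prod IK) ∞ (fun y => (π y, κ y)) (π ⁻¹' U) :=
      hπ.contMDiffOn.prodMk h.smooth_gauge
    have h2 : ContMDiffOn (IB.prod IK) IP ∞ (fun x : B × K => x.2 • s x.1) (U ×ˢ univ) :=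
      hsmul.comp_contMDiffOn (contMDiffOn_snd.prodMk
        (h.smooth_section.comp contMDiffOn_fst fun x hx => hx.1))
    have hmem : ∀ x : B × K, x ∈ U ×ˢ (univ : Set K) → π (x.2 • s x.1) = x.1 := fun x hx => by
      rw [hπK, h.proj_section _ hx.1]
    refine ⟨{ toFun := fun y => (π y, κ y)
              invFun := fun x => x.2 • s x.1
              source := π ⁻¹' U
              target := U ×ˢ univ
              map_source' := fun y hy => ⟨hy, mem_univ _⟩
              map_target' := fun x hx => by
                rw [mem_preimage, hmem x hx]; exact hx.1
              left_inv' := fun y hy => h.gauge_smul_section y hy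
              right_inv' := fun x hx => by
                refine Prod.ext (hmem x hx) ?_
                change κ (x.2 • s x.1) = x.2
                rw [h.gauge_smul _ _ (by rw [h.proj_section _ hx.1]; exact hx.1),
                  h.gauge_section hx.1, mul_one]
              open_source := h.isOpen.preimage hπ.continuous
              open_target := h.isOpen.prod isOpen_univ
              continuousOn_toFun := h1.continuousOn
              continuousOn_invFun := h2.continuousOn
              baseSet := U
              open_baseSet := h.isOpen
              source_eq := rfl
              target_eq := rfl
              proj_toFun := fun _ _ => rfl }, hb, h1, h2, fun k y hy => ?_⟩
    exact ⟨hπK k y, h.gauge_smul k y hy⟩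

end IsPrincipalBundle

end Gauges

/-! ### The quotient bundle `P/G → M/G` -/

section QuotientMaps

variable {G K P M : Type*} [Group G] [Group K] [MulAction G P] [MulAction K P]
  [SMulCommClass G K P] [MulAction G M] {p : P → M}

theorem quotientProj_smul (k : K) (y : P) :
    quotientProj G P (k • y) = k • quotientProj G P y := rfl

theorem quotientProj_smul_self (g : G) (y : P) :
    quotientProj G P (g • y) = quotientProj G P y :=
  Quotient.sound ⟨g, rfl⟩

theorem quotientMap_quotientProj (hpG : ∀ (g : G) (y : P), p (g • y) = g • p y) (y : P) :
    quotientMap p hpG (quotientProj G P y) = quotientProj G M (p y) := rfl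

end QuotientMaps

section QuotientBundle

variable {EK : Type*} [NormedAddCommGroup EK] [NormedSpace ℝ EK]
  {HK : Type*} [TopologicalSpace HK] {IK : ModelWithCorners ℝ EK HK}
  {K : Type*} [Group K] [TopologicalSpace K] [ChartedSpace HK K]
  {EG : Type*} [NormedAddCommGroup EG] [NormedSpace ℝ EG]
  {HG : Type*} [TopologicalSpace HG] {IG : ModelWithCorners ℝ EG HG}
  {G : Type*} [Group G] [TopologicalSpace G] [ChartedSpace HG G]
  {EM : Type*} [NormedAddCommGroup EM] [NormedSpace ℝ EM]
  {HM : Type*} [TopologicalSpace HM] {IM : ModelWithCorners ℝ EM HM}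
  {M : Type*} [TopologicalSpace M] [ChartedSpace HM M]
  {EP : Type*} [NormedAddCommGroup EP] [NormedSpace ℝ EP]
  {HP : Type*} [TopologicalSpace HP] {IP : ModelWithCorners ℝ EP HP}
  {P : Type*} [TopologicalSpace P] [ChartedSpace HP P]
  [MulAction K P] [MulAction G M] [MulAction G P] [SMulCommClass G K P]
  {p : P → M}
  {EPG : Type*} [NormedAddCommGroup EPG] [NormedSpace ℝ EPG]
  {HPG : Type*} [TopologicalSpace HPG] {IPG : ModelWithCorners ℝ EPG HPG}
  [ChartedSpace HPG (orbitRel.Quotient G P)]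
  {EMG : Type*} [NormedAddCommGroup EMG] [NormedSpace ℝ EMG]
  {HMG : Type*} [TopologicalSpace HMG] {IMG : ModelWithCorners ℝ EMG HMG}
  [ChartedSpace HMG (orbitRel.Quotient G M)]

/-- The induced action on the quotient of the total space of a principal bundle is smooth. -/
theorem contMDiff_smul_quotient
    (hsmul : ContMDiff (IK.prod IP) IP ∞ (fun x : K × P => x.1 • x.2))
    (hqP : IsPrincipalBundle IG IP IPG G (quotientProj G P)) :
    ContMDiff (IK.prod IPG) IPG ∞ (fun x : K × orbitRel.Quotient G P => x.1 • x.2) := by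
  rintro ⟨k, z⟩
  obtain ⟨U, s, κ, hz, h⟩ := hqP.exists_localGauge z
  have hU := h.isOpen.mem_nhds hz
  have hs : ContMDiffAt (IK.prod IPG) IP ∞ (fun x : K × orbitRel.Quotient G P => s x.2) (k, z) :=
    (h.smooth_section.contMDiffAt hU).comp (k, z) contMDiffAt_snd
  have h1 := (hqP.contMDiff_proj.comp hsmul).contMDiffAt.comp (k, z) (contMDiffAt_fst.prodMk hs)
  refine h1.congr_of_eventuallyEq ?_
  filter_upwards [(h.isOpen.preimage continuous_snd).mem_nhds
    (show (k, z) ∈ Prod.snd ⁻¹' U from hz)] with x hx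
  change x.1 • x.2 = x.1 • quotientProj G P (s x.2)
  rw [h.proj_section _ hx]

/-- If a principal `K`-bundle `P → M` is equivariant under a group `G` for which `P → P/G` and
`M → M/G` are principal bundles, then `P/G → M/G` is a principal `K`-bundle. -/
theorem IsPrincipalBundle.quotientMap [LieGroup IG ∞ G]
    (hp : IsPrincipalBundle IK IP IM K p)
    (hpG : ∀ (g : G) (y : P), p (g • y) = g • p y)
    (hqP : IsPrincipalBundle IG IP IPG G (quotientProj G P))
    (hqM : IsPrincipalBundle IG IM IMG G (quotientProj G M)) :
    IsPrincipalBundle IK IPG IMG K (quotientMap p hpG) := by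
  have hπ : ContMDiff IPG IMG ∞ (_root_.quotientMap p hpG) := fun z =>
    hqP.contMDiffAt_of_comp fun y _ => (hqM.contMDiff_proj.comp hp.contMDiff_proj).contMDiffAt
  refine .of_localGauges (contMDiff_smul_quotient hp.smooth_smul hqP) hπ ?_ fun b => ?_
  · rintro k ⟨y⟩
    exact congrArg (quotientProj G M) (hp.proj_smul k y)
  obtain ⟨U, s, κ, hb, h⟩ := hqM.exists_localGauge b
  obtain ⟨V, t, l, hV, h'⟩ := hp.exists_localGauge (s b)
  -- The point `(κ (p y))⁻¹ • y` is the representative of the `G`-orbit of `y` that lies over the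
  -- section `s`. It depends only on the orbit, so any function of it descends to `P/G`.
  have hκ : ∀ (g : G) (y : P), quotientProj G M (p y) ∈ U →
      (κ (p (g • y)))⁻¹ • g • y = (κ (p y))⁻¹ • y := fun g y hy => by
    rw [hpG, h.gauge_smul g _ hy, mul_inv_rev, mul_smul, inv_smul_smul]
  have hpκ : ∀ y : P, quotientProj G M (p y) ∈ U →
      p ((κ (p y))⁻¹ • y) = s (quotientProj G M (p y)) := fun y hy => by
    rw [hpG, h.inv_gauge_smul hy]
  classical
  set W : Set (orbitRel.Quotient G M) := U ∩ s ⁻¹' V with hW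
  have hWo : IsOpen W := h.smooth_section.continuousOn.isOpen_inter_preimage h.isOpen h'.isOpen
  -- The gauge `l` of `P → M` is read off at the normalized representative. The value `1` off `W` is
  -- a dummy.
  let Λ : orbitRel.Quotient G P → K := Quotient.lift
    (fun y => if quotientProj G M (p y) ∈ W then l ((κ (p y))⁻¹ • y) else 1) (by
      rintro _ y ⟨g, rfl⟩
      simp only [hpG, quotientProj_smul_self]
      split_ifs with hy
      · rw [← hpG, hκ g y hy.1]
      · rfl)
  have hΛ : ∀ y : P, quotientProj G M (p y) ∈ W →
      Λ (quotientProj G P y) = l ((κ (p y))⁻¹ • y) := fun y hy => if_pos hy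
  have hlV : ∀ y : P, quotientProj G M (p y) ∈ W → p ((κ (p y))⁻¹ • y) ∈ V := fun y hy => by
    rw [hpκ y hy.1]; exact hy.2
  refine ⟨W, fun x => quotientProj G P (t (s x)), Λ, ⟨hb, hV⟩, hWo, ?_, ?_, ?_, ?_, ?_⟩
  · exact hqP.contMDiff_proj.comp_contMDiffOn (h'.smooth_section.comp
      (h.smooth_section.mono inter_subset_left) fun x hx => hx.2)
  · intro x hx
    rw [quotientMap_quotientProj, h'.proj_section _ hx.2, h.proj_section _ hx.1]
  · intro z hz
    refine (hqP.contMDiffAt_of_comp fun y hy => ?_).contMDiffWithinAt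
    subst hy
    have hyW : quotientProj G M (p y) ∈ W := hz
    have hq := hqM.contMDiff_proj.comp hp.contMDiff_proj
    have hO : (fun y => quotientProj G M (p y)) ⁻¹' W ∈ nhds y :=
      (hWo.preimage hq.continuous).mem_nhds hyW
    have h1 : ContMDiffAt IP IG ∞ (fun y => (κ (p y))⁻¹) y :=
      ((h.smooth_gauge.contMDiffAt ((h.isOpen.preimage hqM.contMDiff_proj.continuous).mem_nhds
        hyW.1)).comp y hp.contMDiff_proj.contMDiffAt).inv
    have h2 : ContMDiffAt IP IP ∞ (fun y => (κ (p y))⁻¹ • y) y :=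
      hqP.smooth_smul.contMDiffAt.comp y (h1.prodMk contMDiffAt_id)
    have h3 : ContMDiffAt IP IK ∞ (fun y => l ((κ (p y))⁻¹ • y)) y :=
      ContMDiffAt.comp y (h'.smooth_gauge.contMDiffAt
        ((h'.isOpen.preimage hp.contMDiff_proj.continuous).mem_nhds (hlV y hyW))) h2
    refine h3.congr_of_eventuallyEq ?_
    filter_upwards [hO] with x hx using hΛ x hx
  · rintro k ⟨y⟩ hy
    have hyW : quotientProj G M (p y) ∈ W := hy
    change Λ (quotientProj G P (k • y)) = k * Λ (quotientProj G P y)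
    rw [hΛ y hyW, hΛ (k • y) (by rwa [hp.proj_smul]), hp.proj_smul, smul_comm,
      h'.gauge_smul k _ (hlV y hyW)]
  · rintro ⟨y⟩ hy
    have hyW : quotientProj G M (p y) ∈ W := hy
    change Λ (quotientProj G P y) • quotientProj G P (t (s (quotientProj G M (p y)))) =
      quotientProj G P y
    rw [hΛ y hyW, ← hpκ y hyW.1, ← quotientProj_smul, h'.gauge_smul_section _ (hlV y hyW),
      quotientProj_smul_self]

end QuotientBundle

/-! ### Basic `1`-forms and their descent -/

section Descent

variable {EK : Type*} [NormedAddCommGroup EK] [NormedSpace ℝ EK]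
  {HK : Type*} [TopologicalSpace HK] {IK : ModelWithCorners ℝ EK HK}
  {K : Type*} [Group K] [TopologicalSpace K] [ChartedSpace HK K]
  {EP : Type*} [NormedAddCommGroup EP] [NormedSpace ℝ EP]
  {HP : Type*} [TopologicalSpace HP] {IP : ModelWithCorners ℝ EP HP}
  {P : Type*} [TopologicalSpace P] [ChartedSpace HP P]
  {EB : Type*} [NormedAddCommGroup EB] [NormedSpace ℝ EB]
  {HB : Type*} [TopologicalSpace HB] {IB : ModelWithCorners ℝ EB HB}
  {B : Type*} [TopologicalSpace B] [ChartedSpace HB B]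
  {EN : Type*} [NormedAddCommGroup EN] [NormedSpace ℝ EN]
  {HN : Type*} [TopologicalSpace HN] {IN : ModelWithCorners ℝ EN HN}
  {N : Type*} [TopologicalSpace N] [ChartedSpace HN N]
  [MulAction K P] {q : P → B}

/-- All tangent spaces are definitionally the model space, so a base point can be replaced by an
equal one without transporting `v`. -/
theorem OneForm.apply_congr (Ξ : OneForm IP P) {y z : P}
    (h : y = z) (v : EP) :
    (Ξ y : EP →L[ℝ] ℂ) v = (Ξ z : EP →L[ℝ] ℂ) v := by
  rw [h]

/-- The product rule for the pairing of an invariant `1`-form with the derivative of `x ↦ a x • b x`. -/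
theorem IsInvariantForm.apply_mfderivWithin_smul
    (hsmul : ContMDiff (IK.prod IP) IP ∞ (fun x : K × P => x.1 • x.2))
    {Ξ : OneForm IP P} (hΞ : IsInvariantForm K Ξ) {a : N → K} {b : N → P} {s : Set N} {n : N}
    (ha : MDifferentiableWithinAt IN IK a s n) (hb : MDifferentiableWithinAt IN IP b s n)
    (hs : UniqueMDiffWithinAt IN s n) (v : TangentSpace IN n) :
    Ξ (a n • b n) (mfderivWithin IN IP (fun x => a x • b x) s n v) =
      Ξ (a n • b n) (mfderiv IK IP (fun k : K => k • b n) (a n) (mfderivWithin IN IK a s n v)) +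
        Ξ (b n) (mfderivWithin IN IP b s n v) := by
  have hF : MDifferentiableAt (IK.prod IP) IP (fun x : K × P => x.1 • x.2) (a n, b n) :=
    hsmul.mdifferentiableAt (by simp)
  have h1 : mfderivWithin IN IP (fun x => a x • b x) s n v =
      mfderiv (IK.prod IP) IP (fun x : K × P => x.1 • x.2) (a n, b n)
        (mfderivWithin IN (IK.prod IP) (fun x => (a x, b x)) s n v) := by
    have := mfderiv_comp_mfderivWithin (I' := IK.prod IP) n (f := fun x => (a x, b x))
      (g := fun x : K × P => x.1 • x.2) hF (ha.prodMk hb) hs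
    exact congrArg (fun L => L v) this
  have h2 : mfderivWithin IN (IK.prod IP) (fun x => (a x, b x)) s n v =
      (mfderivWithin IN IK a s n v, mfderivWithin IN IP b s n v) := by
    rw [(ha.hasMFDerivWithinAt.prodMk hb.hasMFDerivWithinAt).mfderivWithin hs]
    rfl
  -- The derivative of the action splits into two partial derivatives. The one in `P` is that of
  -- translation by `a n`, which invariance removes.
  rw [h1, mfderiv_prod_eq_add_apply hF, h2]
  exact (map_add (Ξ (a n • b n)) _ _).trans (congrArg₂ (· + ·) rfl (hΞ (a n) (b n) _))

/-- A `1`-form that vanishes on the fundamental vector fields vanishes on all orbit directions. -/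
theorem OneForm.apply_orbit_eq_zero [LieGroup IK ∞ K]
    (hsmul : ContMDiff (IK.prod IP) IP ∞ (fun x : K × P => x.1 • x.2)) {Ξ : OneForm IP P}
    (hΞ : ∀ (X : GroupLieAlgebra IK K) (y : P), Ξ _ (fundamentalField IP IK X y) = 0)
    (k : K) (y : P) (X : TangentSpace IK k) :
    Ξ (k • y) (mfderiv IK IP (fun g : K => g • y) k X) = 0 := by
  have hf : MDifferentiableAt IK IK (fun g : K => k * g⁻¹) k :=
    ((contMDiff_const.mul (contMDiff_inv IK ∞)).mdifferentiable (by simp)) k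
  have hg : MDifferentiableAt IK IP (fun h : K => h⁻¹ • k • y) 1 :=
    ((hsmul.comp ((contMDiff_inv IK ∞).prodMk contMDiff_const)).mdifferentiable (by simp)) 1
  -- Fundamental fields only see the derivative of `h ↦ h⁻¹ • z` at `1`. The orbit map is therefore
  -- factored through `g ↦ k * g⁻¹`, which sends `k` to `1`.
  have h1 : (fun g : K => g • y) = (fun h : K => h⁻¹ • k • y) ∘ fun g : K => k * g⁻¹ := by
    funext g
    simp [mul_smul]
  have h2 := mfderiv_comp_of_eq (x := k) hg hf (mul_inv_cancel k)
  rw [← h1] at h2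
  have h3 : ∀ g : K, g = 1 → ∀ Y : TangentSpace IK g,
      Ξ (g⁻¹ • k • y) (mfderiv IK IP (fun h : K => h⁻¹ • k • y) g Y) = 0 := by
    rintro _ rfl Y
    exact hΞ Y (k • y)
  rw [h2]
  refine (OneForm.apply_congr Ξ ?_ _).trans (h3 _ (mul_inv_cancel k) _)
  simp

/-- A basic `1`-form is determined by its restriction to a local section. -/
theorem IsInvariantForm.apply_eq_section [LieGroup IK ∞ K]
    (hq : IsPrincipalBundle IK IP IB K q) {Ξ : OneForm IP P} (hΞ : IsInvariantForm K Ξ)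
    (hΞ' : ∀ (X : GroupLieAlgebra IK K) (y : P), Ξ _ (fundamentalField IP IK X y) = 0)
    {U : Set B} {s : B → P} {κ : P → K} (h : IsLocalGauge IK IP IB q U s κ) {y : P}
    (hy : q y ∈ U) (v : TangentSpace IP y) :
    Ξ y v = Ξ (s (q y)) (mfderiv IB IP s (q y) (mfderiv IP IB q y v)) := by
  have hU : q ⁻¹' U ∈ nhds y := (h.isOpen.preimage hq.contMDiff_proj.continuous).mem_nhds hy
  have hκ : MDifferentiableAt IP IK κ y :=
    (h.smooth_gauge.contMDiffAt hU).mdifferentiableAt (by simp)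
  have hs : MDifferentiableAt IB IP s (q y) :=
    (h.smooth_section.contMDiffAt (h.isOpen.mem_nhds hy)).mdifferentiableAt (by simp)
  have hqy : MDifferentiableAt IP IB q y := hq.contMDiff_proj.mdifferentiableAt (by simp)
  -- Near `y` the identity map is `x ↦ κ x • s (q x)`. In the product rule, the term that
  -- differentiates `κ` is an orbit direction and vanishes.
  have key := hΞ.apply_mfderivWithin_smul hq.smooth_smul (s := univ) (a := κ)
    (b := s ∘ q) hκ.mdifferentiableWithinAt (hs.comp y hqy).mdifferentiableWithinAt
    (uniqueMDiffWithinAt_univ IP) v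
  simp only [mfderivWithin_univ] at key
  have h1 : (fun x => κ x • (s ∘ q) x) =ᶠ[nhds y] id := by
    filter_upwards [hU] with x hx using h.gauge_smul_section x hx
  rw [OneForm.apply_orbit_eq_zero hq.smooth_smul hΞ', zero_add, h1.mfderiv_eq, mfderiv_id,
    mfderiv_comp_apply y hs hqy] at key
  refine Eq.trans ?_ key
  exact OneForm.apply_congr Ξ (h.gauge_smul_section y hy).symm v

/-- Differentiating `q ∘ s = id` gives a right inverse of the derivative of `q` at `s b`. -/
theorem IsPrincipalBundle.mfderiv_surjective (hq : IsPrincipalBundle IK IP IB K q) (b : B) :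
    ∃ y, q y = b ∧ ∀ w : EB, ∃ v : EP, (mfderiv IP IB q y : EP →L[ℝ] EB) v = w := by
  obtain ⟨U, s, κ, hb, h⟩ := hq.exists_localGauge b
  have hU := h.isOpen.mem_nhds hb
  refine ⟨s b, h.proj_section b hb, fun w => ⟨(mfderiv IB IP s b : EB →L[ℝ] EP) w, ?_⟩⟩
  have hs : MDifferentiableAt IB IP s b :=
    (h.smooth_section.contMDiffAt hU).mdifferentiableAt (by simp)
  have h1 : q ∘ s =ᶠ[nhds b] id := by
    filter_upwards [hU] with x hx using h.proj_section x hx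
  have h2 := mfderiv_comp_apply b (hq.contMDiff_proj.mdifferentiableAt (x := s b) (by simp)) hs w
  rw [h1.mfderiv_eq, mfderiv_id] at h2
  exact h2.symm

/-- A `1`-form on the base of a principal bundle is determined by its pull-back. -/
theorem IsPrincipalBundle.oneForm_ext (hq : IsPrincipalBundle IK IP IB K q) {Θ Θ' : OneForm IB B}
    (h : ∀ (y : P) (v : TangentSpace IP y),
      Θ (q y) (mfderiv IP IB q y v) = Θ' (q y) (mfderiv IP IB q y v)) : Θ = Θ' := by
  funext b
  obtain ⟨y, rfl, hy⟩ := hq.mfderiv_surjective b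
  ext w
  obtain ⟨v, rfl⟩ := hy w
  exact h y v

/-- An invariant `1`-form that vanishes on the orbit directions descends to the base. -/
theorem IsInvariantForm.exists_descent [LieGroup IK ∞ K]
    (hq : IsPrincipalBundle IK IP IB K q) {Ξ : OneForm IP P} (hΞ : IsInvariantForm K Ξ)
    (hΞ' : ∀ (X : GroupLieAlgebra IK K) (y : P), Ξ _ (fundamentalField IP IK X y) = 0) :
    ∃ Θ : OneForm IB B, ∀ (y : P) (v : TangentSpace IP y),
      Θ (q y) (mfderiv IP IB q y v) = Ξ y v := by
  choose U s κ hU h using hq.exists_localGauge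
  -- A separate section may be used for each base point, since `apply_eq_section` makes the value
  -- independent of the choice. Smoothness is settled later, in `contMDiff_oneForm`.
  exact ⟨fun b => (Ξ (s b b)).comp (mfderiv IB IP (s b) b),
    fun y v => (hΞ.apply_eq_section hq hΞ' (h (q y)) (hU (q y)) v).symm⟩

/-- A `1`-form on the base of a principal bundle is smooth if its pull-back is. -/
theorem IsPrincipalBundle.contMDiff_oneForm [IsManifold IP 1 P] [IsManifold IB 1 B]
    (hq : IsPrincipalBundle IK IP IB K q) {Ξ : OneForm IP P} {Θ : OneForm IB B}
    (h : ∀ (y : P) (v : TangentSpace IP y), Θ (q y) (mfderiv IP IB q y v) = Ξ y v)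
    (hΞ : ContMDiff IP.tangent 𝓘(ℝ, ℂ) ∞ (fun v : TangentBundle IP P => Ξ v.proj v.snd)) :
    ContMDiff IB.tangent 𝓘(ℝ, ℂ) ∞ (fun v : TangentBundle IB B => Θ v.proj v.snd) := by
  rintro ⟨b, w⟩
  obtain ⟨U, s, κ, hb, hU⟩ := hq.exists_localGauge b
  have h1 := hU.smooth_section.contMDiffOn_tangentMapWithin (m := ∞) (by simp)
    hU.isOpen.uniqueMDiffOn
  have hO : IsOpen ((Bundle.TotalSpace.proj : TangentBundle IB B → B) ⁻¹' U) :=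
    hU.isOpen.preimage (FiberBundle.continuous_proj EB (TangentSpace IB))
  -- Over `U` the form `Θ` is the pull-back of `Ξ` by the smooth section `s`.
  refine ((hΞ.comp_contMDiffOn h1).contMDiffAt (hO.mem_nhds hb)).congr_of_eventuallyEq ?_
  filter_upwards [hO.mem_nhds (show (⟨b, w⟩ : TangentBundle IB B) ∈ _ from hb)]
  rintro ⟨x, u⟩ (hx : x ∈ U)
  have hs : MDifferentiableAt IB IP s x :=
    (hU.smooth_section.contMDiffAt (hU.isOpen.mem_nhds hx)).mdifferentiableAt (by simp)
  have h2 : q ∘ s =ᶠ[nhds x] id := by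
    filter_upwards [hU.isOpen.mem_nhds hx] with z hz using hU.proj_section z hz
  have h3 := mfderiv_comp_apply x (hq.contMDiff_proj.mdifferentiableAt (x := s x) (by simp)) hs u
  rw [h2.mfderiv_eq, mfderiv_id] at h3
  change Θ x u = Ξ (s x) (mfderivWithin IB IP s U x u)
  rw [mfderivWithin_of_isOpen hU.isOpen hx, ← h (s x)]
  exact ((OneForm.apply_congr Θ (hU.proj_section x hx) _).trans (congrArg (Θ x) h3.symm)).symm

end Descent

/-! ### Connection forms on `U(1)`-bundles -/

section CircleConnections

variable {EP : Type*} [NormedAddCommGroup EP] [NormedSpace ℝ EP]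
  {HP : Type*} [TopologicalSpace HP] {IP : ModelWithCorners ℝ EP HP}
  {P : Type*} [TopologicalSpace P] [ChartedSpace HP P]

theorem mdifferentiable_smul_left {K : Type*} {EK : Type*} [NormedAddCommGroup EK]
    [NormedSpace ℝ EK] {HK : Type*} [TopologicalSpace HK] {IK : ModelWithCorners ℝ EK HK}
    [TopologicalSpace K] [ChartedSpace HK K] [SMul K P]
    (hsmul : ContMDiff (IK.prod IP) IP ∞ (fun x : K × P => x.1 • x.2)) (k : K) :
    MDifferentiable IP IP (fun y : P => k • y) :=
  (hsmul.comp (contMDiff_const.prodMk contMDiff_id)).mdifferentiable (by simp)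

variable [MulAction Circle P]

theorem mdifferentiable_circleExp_smul
    (hsmul : ContMDiff ((𝓡 1).prod IP) IP ∞ (fun x : Circle × P => x.1 • x.2)) (y : P) :
    MDifferentiable 𝓘(ℝ, ℝ) IP (fun t : ℝ => Circle.exp t • y) :=
  (hsmul.comp (contMDiff_circleExp.prodMk contMDiff_const)).mdifferentiable (by simp)

variable [IsManifold IP 1 P] {Ξ : OneForm IP P}

/-- A form whose pull-back along an equivariant principal bundle projection `q` is a
connection form is itself a connection form. -/
theorem IsConnectionForm.of_pullback {EK : Type*} [NormedAddCommGroup EK] [NormedSpace ℝ EK]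
    {HK : Type*} [TopologicalSpace HK] {IK : ModelWithCorners ℝ EK HK}
    {K : Type*} [Group K] [TopologicalSpace K] [ChartedSpace HK K] [MulAction K P]
    {EB : Type*} [NormedAddCommGroup EB] [NormedSpace ℝ EB]
    {HB : Type*} [TopologicalSpace HB] {IB : ModelWithCorners ℝ EB HB}
    {B : Type*} [TopologicalSpace B] [ChartedSpace HB B] [IsManifold IB 1 B] [MulAction Circle B]
    {q : P → B} (hq : IsPrincipalBundle IK IP IB K q)
    (hqc : ∀ (u : Circle) (y : P), q (u • y) = u • q y)
    (hP : ContMDiff ((𝓡 1).prod IP) IP ∞ (fun x : Circle × P => x.1 • x.2))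
    (hB : ContMDiff ((𝓡 1).prod IB) IB ∞ (fun x : Circle × B => x.1 • x.2))
    (hΞ : IsConnectionForm Ξ) {Θ : OneForm IB B}
    (h : ∀ (y : P) (v : TangentSpace IP y), Θ (q y) (mfderiv IP IB q y v) = Ξ y v) :
    IsConnectionForm Θ where
  smooth := hq.contMDiff_oneForm h hΞ.smooth
  imaginary b w := by
    obtain ⟨y, rfl, hy⟩ := hq.mfderiv_surjective b
    obtain ⟨v, rfl⟩ := hy w
    exact (congrArg Complex.re (h y v)).trans (hΞ.imaginary y v)
  invariant u b w := by
    obtain ⟨y, rfl, hy⟩ := hq.mfderiv_surjective b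
    obtain ⟨v, rfl⟩ := hy w
    have hqd : MDifferentiable IP IB q := hq.contMDiff_proj.mdifferentiable (by simp)
    have h1 := mfderiv_comp_apply y (mdifferentiable_smul_left hB u (q y)) (hqd y) v
    have h2 := mfderiv_comp_apply y (hqd (u • y)) (mdifferentiable_smul_left hP u y) v
    have h3 : q ∘ (fun z : P => u • z) = (fun z : B => u • z) ∘ q := funext fun z => hqc u z
    rw [h3, h1] at h2
    refine (congrArg (Θ (u • q y)) h2).trans ?_
    refine (OneForm.apply_congr Θ (hqc u y).symm _).trans ?_
    exact ((h (u • y) _).trans (hΞ.invariant u y v)).trans (h y v).symm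
  vertical b := by
    obtain ⟨y, rfl⟩ := hq.surjective b
    have hqd : MDifferentiable IP IB q := hq.contMDiff_proj.mdifferentiable (by simp)
    have h2 := mfderiv_comp_apply (I := 𝓘(ℝ, ℝ)) (0 : ℝ) (hqd _)
      (mdifferentiable_circleExp_smul hP y 0) (1 : ℝ)
    have h3 : q ∘ (fun t : ℝ => Circle.exp t • y) = fun t : ℝ => Circle.exp t • q y :=
      funext fun t => hqc _ y
    rw [h3] at h2
    refine (congrArg (Θ (Circle.exp 0 • q y)) h2).trans ?_
    refine (OneForm.apply_congr Θ (hqc _ y).symm _).trans ?_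
    exact (h _ _).trans (hΞ.vertical y)

namespace IsConnectionForm

/-- By the one-parameter group law, time `r` on the orbit of `y` is time `0` on the orbit of
`Circle.exp r • y`, where `vertical` applies. -/
theorem apply_mfderiv_circleExp_smul
    (hsmul : ContMDiff ((𝓡 1).prod IP) IP ∞ (fun x : Circle × P => x.1 • x.2))
    (hΞ : IsConnectionForm Ξ) (r : ℝ) (y : P) :
    Ξ (Circle.exp r • y) (mfderiv 𝓘(ℝ, ℝ) IP (fun t : ℝ => Circle.exp t • y) r (1 : ℝ)) =
      Complex.I := by
  have h1 : (fun t : ℝ => Circle.exp t • y) =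
      (fun t : ℝ => Circle.exp t • Circle.exp r • y) ∘ fun t : ℝ => t - r := by
    funext t
    simp [smul_smul, ← Circle.exp_add]
  have hd : HasMFDerivAt 𝓘(ℝ, ℝ) 𝓘(ℝ, ℝ) (fun t : ℝ => t - r) r (ContinuousLinearMap.id ℝ ℝ) :=
    ((hasFDerivAt_id r).sub_const r).hasMFDerivAt
  have h2 := mfderiv_comp_apply (f := fun t : ℝ => t - r) r
    (mdifferentiable_circleExp_smul hsmul (Circle.exp r • y) (r - r)) hd.mdifferentiableAt (1 : ℝ)
  rw [← h1, hd.mfderiv] at h2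
  have h3 : ∀ x : ℝ, x = 0 → Ξ (Circle.exp x • Circle.exp r • y)
      (mfderiv 𝓘(ℝ, ℝ) IP (fun t : ℝ => Circle.exp t • Circle.exp r • y) x (1 : ℝ)) =
        Complex.I := by
    rintro _ rfl
    exact hΞ.vertical _
  refine (congrArg (Ξ (Circle.exp r • y)) h2).trans ?_
  refine (OneForm.apply_congr Ξ ?_ _).trans (h3 _ (sub_self r))
  simp

/-- A gauge transformation `c ↦ exp(iθ) · c` of a curve changes `Ξ(ċ)` by `iθ'`. -/
theorem apply_mfderivWithin_circleExp_smul
    (hsmul : ContMDiff ((𝓡 1).prod IP) IP ∞ (fun x : Circle × P => x.1 • x.2))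
    (hΞ : IsConnectionForm Ξ) {θ : ℝ → ℝ} {c : ℝ → P} {s : Set ℝ} {t θ' : ℝ}
    (hθ : HasDerivWithinAt θ θ' s t) (hc : MDifferentiableWithinAt 𝓘(ℝ, ℝ) IP c s t)
    (hs : UniqueDiffWithinAt ℝ s t) :
    Ξ (Circle.exp (θ t) • c t)
        (mfderivWithin 𝓘(ℝ, ℝ) IP (fun x => Circle.exp (θ x) • c x) s t (1 : ℝ)) =
      θ' * Complex.I + Ξ (c t) (mfderivWithin 𝓘(ℝ, ℝ) IP c s t (1 : ℝ)) := by
  have hs' : UniqueMDiffWithinAt 𝓘(ℝ, ℝ) s t := hs.uniqueMDiffWithinAt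
  have hθm : MDifferentiableWithinAt 𝓘(ℝ, ℝ) 𝓘(ℝ, ℝ) θ s t :=
    hθ.differentiableWithinAt.mdifferentiableWithinAt
  have he : MDifferentiable 𝓘(ℝ, ℝ) (𝓡 1) Circle.exp :=
    (contMDiff_circleExp (m := ∞)).mdifferentiable (by simp)
  have hk : MDifferentiable (𝓡 1) IP (fun k : Circle => k • c t) :=
    (hsmul.comp (contMDiff_id.prodMk contMDiff_const)).mdifferentiable (by simp)
  have key := hΞ.invariant.apply_mfderivWithin_smul hsmul (a := fun x => Circle.exp (θ x))
    ((he _).comp_mdifferentiableWithinAt t hθm) hc hs' (1 : ℝ)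
  refine key.trans (congrArg (· + _) ?_)
  have h1 := mfderiv_comp_mfderivWithin t (he (θ t)) hθm hs'
  have h2 := mfderiv_comp_apply (θ t) (hk (Circle.exp (θ t))) (he (θ t))
    (mfderivWithin 𝓘(ℝ, ℝ) 𝓘(ℝ, ℝ) θ s t (1 : ℝ))
  have h3 : mfderivWithin 𝓘(ℝ, ℝ) 𝓘(ℝ, ℝ) θ s t (1 : ℝ) = θ' • (1 : ℝ) := by
    rw [mfderivWithin_eq_fderivWithin]
    exact (hθ.derivWithin hs).trans (by simp)
  have h4 := apply_mfderiv_circleExp_smul hsmul hΞ (θ t) (c t)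
  have h5 : mfderiv (𝓡 1) IP (fun k : Circle => k • c t) (Circle.exp (θ t))
      (mfderivWithin 𝓘(ℝ, ℝ) (𝓡 1) (fun x => Circle.exp (θ x)) s t (1 : ℝ)) =
      θ' • mfderiv 𝓘(ℝ, ℝ) IP (fun r : ℝ => Circle.exp r • c t) (θ t) (1 : ℝ) := by
    refine Eq.trans ?_ (h2.symm.trans ?_)
    · exact congrArg (fun L => mfderiv (𝓡 1) IP (fun k : Circle => k • c t) (Circle.exp (θ t))
        (L (1 : ℝ))) h1
    · rw [h3]
      exact map_smul _ θ' (1 : ℝ)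
  refine (congrArg (Ξ (Circle.exp (θ t) • c t)) h5).trans ?_
  refine (map_smul (Ξ (Circle.exp (θ t) • c t)) θ' _).trans ?_
  refine (congrArg (θ' • ·) h4).trans ?_
  simp

end IsConnectionForm

end CircleConnections

/-! ### Subdivisions and piecewise `C¹` curves -/

section Subdivisions

/-- The interval ends at the first subdivision point beyond `x`, so monotonicity of `t` is not
needed. -/
theorem exists_mem_Ico_subdivision {n : ℕ} {t : ℕ → ℝ} {x : ℝ} (h0 : t 0 ≤ x) (hn : x < t n) :
    ∃ i < n, x ∈ Ico (t i) (t (i + 1)) := by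
  classical
  have hex : ∃ j, x < t j := ⟨n, hn⟩
  have hpos : Nat.find hex ≠ 0 := fun h => (Nat.find_spec hex).not_ge (h ▸ h0)
  obtain ⟨i, hi⟩ := Nat.exists_eq_succ_of_ne_zero hpos
  have hle : Nat.find hex ≤ n := Nat.find_min' hex hn
  refine ⟨i, by omega, not_lt.1 (Nat.find_min hex (by omega)), ?_⟩
  have := Nat.find_spec hex
  rwa [hi] at this

variable {X : Type*} [TopologicalSpace X]

theorem continuousOn_Icc_of_subdivision {c : ℝ → X} {t : ℕ → ℝ} (ht : Monotone t) {n : ℕ}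
    (h : ∀ i < n, ContinuousOn c (Icc (t i) (t (i + 1)))) : ContinuousOn c (Icc (t 0) (t n)) := by
  induction n with
  | zero => simp
  | succ n ih =>
    rw [← Icc_union_Icc_eq_Icc (ht (Nat.zero_le n)) (ht n.le_succ)]
    exact (ih fun i hi => h i (by omega)).union_of_isClosed (h n (by omega)) isClosed_Icc
      isClosed_Icc

variable {E : Type*} [NormedAddCommGroup E] [NormedSpace ℝ E]
  {H : Type*} [TopologicalSpace H] {I : ModelWithCorners ℝ E H} [ChartedSpace H X] {c : ℝ → X}

theorem IsPiecewiseC1.continuousOn (hc : IsPiecewiseC1 I c) : ContinuousOn c (Icc 0 1) := by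
  obtain ⟨n, t, h0, h1, ht, h⟩ := hc
  rw [← h0, ← h1]
  exact continuousOn_Icc_of_subdivision ht fun i hi => (h i hi).continuousOn

theorem IsPiecewiseC1.exists_countable_mdifferentiableAt (hc : IsPiecewiseC1 I c) :
    ∃ S : Set ℝ, S.Countable ∧ ∀ x ∈ Ioo (0 : ℝ) 1 \ S, MDifferentiableAt 𝓘(ℝ, ℝ) I c x := by
  obtain ⟨n, t, h0, h1, -, h⟩ := hc
  refine ⟨range t, countable_range t, fun x hx => ?_⟩
  obtain ⟨i, hi, hx1, hx2⟩ := exists_mem_Ico_subdivision (t := t) (n := n) (x := x)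
    (by rw [h0]; exact hx.1.1.le) (by rw [h1]; exact hx.1.2)
  have hx3 : t i < x := lt_of_le_of_ne hx1 fun h => hx.2 ⟨i, h⟩
  exact ((h i hi).contMDiffAt (Icc_mem_nhds hx3 hx2)).mdifferentiableAt (by simp)

theorem IsPiecewiseC1.comp {E' : Type*} [NormedAddCommGroup E'] [NormedSpace ℝ E']
    {H' : Type*} [TopologicalSpace H'] {I' : ModelWithCorners ℝ E' H'} {Y : Type*}
    [TopologicalSpace Y] [ChartedSpace H' Y] {f : X → Y} (hf : ContMDiff I I' ∞ f)
    (hc : IsPiecewiseC1 I c) : IsPiecewiseC1 I' (f ∘ c) := by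
  obtain ⟨n, t, h0, h1, ht, h⟩ := hc
  exact ⟨n, t, h0, h1, ht, fun i hi => (hf.of_le (by simp)).comp_contMDiffOn (h i hi)⟩

end Subdivisions

/-! ### Piecewise horizontal curves -/

section Horizontal

variable {EP : Type*} [NormedAddCommGroup EP] [NormedSpace ℝ EP]
  {HP : Type*} [TopologicalSpace HP] {IP : ModelWithCorners ℝ EP HP}
  {P : Type*} [TopologicalSpace P] [ChartedSpace HP P]

/-- `c` is `C¹` on `[a, b]`, and `Ξ` annihilates its one-sided derivatives on `[a, b)`. -/
structure IsHorizontalOn (Ξ : OneForm IP P) (c : ℝ → P) (a b : ℝ) : Prop where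
  contMDiffOn : ContMDiffOn 𝓘(ℝ, ℝ) IP 1 c (Icc a b)
  horizontal : ∀ x ∈ Ico a b, Ξ (c x) (mfderivWithin 𝓘(ℝ, ℝ) IP c (Icc a b) x (1 : ℝ)) = 0

/-- `c` is piecewise `C¹` on `[0, b]`, and horizontal on the pieces including the breakpoints. -/
def IsPiecewiseHorizontal (Ξ : OneForm IP P) (c : ℝ → P) (b : ℝ) : Prop :=
  ∃ (n : ℕ) (t : ℕ → ℝ), t 0 = 0 ∧ t n = b ∧ Monotone t ∧
    ∀ i < n, IsHorizontalOn Ξ c (t i) (t (i + 1))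

variable {Ξ : OneForm IP P} {c d : ℝ → P} {a b : ℝ}

theorem uniqueMDiffWithinAt_Icc_of_mem_Ico {x : ℝ} (hx : x ∈ Ico a b) :
    UniqueMDiffWithinAt 𝓘(ℝ, ℝ) (Icc a b) x :=
  (uniqueDiffOn_Icc (hx.1.trans_lt hx.2) x ⟨hx.1, hx.2.le⟩).uniqueMDiffWithinAt

theorem IsHorizontalOn.congr (hc : IsHorizontalOn Ξ c a b) (h : EqOn d c (Icc a b)) :
    IsHorizontalOn Ξ d a b where
  contMDiffOn := hc.contMDiffOn.congr h
  horizontal x hx := by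
    have hx' : x ∈ Icc a b := ⟨hx.1, hx.2.le⟩
    have h1 := mfderivWithin_congr (I := 𝓘(ℝ, ℝ)) (I' := IP) h (h hx')
    refine Eq.trans ?_ (hc.horizontal x hx)
    rw [h1]
    exact OneForm.apply_congr Ξ (h hx') _

theorem IsPiecewiseHorizontal.isHorizontalLift {M : Type*} {p : P → M} {γ : ℝ → M}
    (hc : IsPiecewiseHorizontal Ξ c 1) (hγ : ∀ t ∈ Icc (0 : ℝ) 1, p (c t) = γ t) :
    IsHorizontalLift p Ξ γ c := by
  obtain ⟨n, t, h0, h1, ht, h⟩ := hc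
  refine ⟨⟨n, t, h0, h1, ht, fun i hi => (h i hi).contMDiffOn⟩, hγ, fun x hx hd => ?_⟩
  obtain ⟨i, hi, hxi⟩ := exists_mem_Ico_subdivision (t := t) (n := n) (x := x)
    (by rw [h0]; exact hx.1.le) (by rw [h1]; exact hx.2)
  have := (h i hi).horizontal x hxi
  rwa [mfderivWithin_eq_mfderiv (uniqueMDiffWithinAt_Icc_of_mem_Ico hxi) hd] at this

/-- This is why one-sided derivatives at breakpoints are recorded: `q ∘ c` can be differentiable
where `c` has a corner, and `IsHorizontalLift` then demands horizontality of `q ∘ c` there. -/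
theorem IsPiecewiseHorizontal.map {EB : Type*} [NormedAddCommGroup EB] [NormedSpace ℝ EB]
    {HB : Type*} [TopologicalSpace HB] {IB : ModelWithCorners ℝ EB HB}
    {B : Type*} [TopologicalSpace B] [ChartedSpace HB B] {q : P → B} (hq : ContMDiff IP IB ∞ q)
    {Θ : OneForm IB B}
    (h : ∀ (y : P) (v : TangentSpace IP y), Θ (q y) (mfderiv IP IB q y v) = Ξ y v)
    (hc : IsPiecewiseHorizontal Ξ c b) : IsPiecewiseHorizontal Θ (q ∘ c) b := by
  obtain ⟨n, t, h0, h1, ht, H⟩ := hc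
  refine ⟨n, t, h0, h1, ht, fun i hi => ⟨(hq.of_le (by simp)).comp_contMDiffOn
    (H i hi).contMDiffOn, fun x hx => ?_⟩⟩
  have h2 := mfderiv_comp_mfderivWithin x (hq.mdifferentiable (by simp) (c x))
    ((H i hi).contMDiffOn.mdifferentiableOn (by simp) x ⟨hx.1, hx.2.le⟩)
    (uniqueMDiffWithinAt_Icc_of_mem_Ico hx)
  rw [h2]
  exact (h (c x) _).trans ((H i hi).horizontal x hx)

theorem IsPiecewiseHorizontal.append (hc : IsPiecewiseHorizontal Ξ c a)
    (hd : IsHorizontalOn Ξ d a b) (hab : a ≤ b) (hcd : c a = d a) :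
    IsPiecewiseHorizontal Ξ (fun x => if x ≤ a then c x else d x) b := by
  obtain ⟨n, t, h0, h1, ht, h⟩ := hc
  -- The old subdivision is kept up to index `n` and continued by the constant `b`, which keeps the
  -- sequence monotone.
  refine ⟨n + 1, fun k => if k ≤ n then t k else b, by simpa using h0, by simp, ?_, fun i hi => ?_⟩
  · intro k l hkl
    dsimp only
    split_ifs with hk hl hl
    · exact ht hkl
    · exact (ht hk).trans (h1.trans_le hab)
    · omega
    · exact le_rfl
  · dsimp only
    rcases (Nat.lt_succ_iff.1 hi).lt_or_eq with hi' | rfl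
    · rw [if_pos hi'.le, if_pos (Nat.succ_le_of_lt hi')]
      refine (h i hi').congr fun x hx => if_pos ?_
      exact hx.2.trans ((ht (Nat.succ_le_of_lt hi')).trans_eq h1)
    · rw [if_pos le_rfl, if_neg (by omega), h1]
      refine hd.congr fun x hx => ?_
      rcases hx.1.eq_or_lt with rfl | hx'
      · simpa using hcd
      · exact if_neg hx'.not_ge

end Horizontal

/-! ### Existence of horizontal lifts -/

section ParallelTransport

variable {EP : Type*} [NormedAddCommGroup EP] [NormedSpace ℝ EP]
  {HP : Type*} [TopologicalSpace HP] {IP : ModelWithCorners ℝ EP HP}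
  {P : Type*} [TopologicalSpace P] [ChartedSpace HP P] [IsManifold IP 1 P]
  {EM : Type*} [NormedAddCommGroup EM] [NormedSpace ℝ EM]
  {HM : Type*} [TopologicalSpace HM] {IM : ModelWithCorners ℝ EM HM}
  {M : Type*} [TopologicalSpace M] [ChartedSpace HM M]
  {p : P → M} {Ξ : OneForm IP P} {γ : ℝ → M} {a b : ℝ}

/-- The pairing of a smooth `1`-form with the derivative of a `C¹` curve is continuous. -/
theorem continuousOn_oneForm_mfderivWithin
    (hΞ : ContMDiff IP.tangent 𝓘(ℝ, ℂ) ∞ (fun v : TangentBundle IP P => Ξ v.proj v.snd))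
    {c : ℝ → P} (hab : a < b) (hc : ContMDiffOn 𝓘(ℝ, ℝ) IP 1 c (Icc a b)) :
    ContinuousOn (fun t => Ξ (c t) (mfderivWithin 𝓘(ℝ, ℝ) IP c (Icc a b) t (1 : ℝ))) (Icc a b) := by
  have h1 := hc.continuousOn_tangentMapWithin le_rfl (uniqueDiffOn_Icc hab).uniqueMDiffOn
  have h2 : Continuous fun t : ℝ => (⟨t, (1 : ℝ)⟩ : TangentBundle 𝓘(ℝ, ℝ) ℝ) :=
    (tangentBundleModelSpaceHomeomorph 𝓘(ℝ, ℝ)).symm.continuous.comp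
      (continuous_id.prodMk continuous_const)
  exact hΞ.continuous.comp_continuousOn (h1.comp h2.continuousOn fun t ht => ht)

variable [MulAction Circle P]

/-- Horizontal lifts exist over curves that stay in the domain of a local gauge. -/
theorem IsConnectionForm.exists_isHorizontalOn (hp : IsPrincipalBundle (𝓡 1) IP IM Circle p)
    (hΞ : IsConnectionForm Ξ) {U : Set M} {s : M → P} {κ : P → Circle}
    (h : IsLocalGauge (𝓡 1) IP IM p U s κ) (hab : a < b)
    (hγ : ContMDiffOn 𝓘(ℝ, ℝ) IM 1 γ (Icc a b)) (hU : ∀ t ∈ Icc a b, γ t ∈ U) {y : P}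
    (hy : p y = γ a) :
    ∃ c, IsHorizontalOn Ξ c a b ∧ c a = y ∧ ∀ t ∈ Icc a b, p (c t) = γ t := by
  set σ : ℝ → P := s ∘ γ with hσ_def
  have hσ : ContMDiffOn 𝓘(ℝ, ℝ) IP 1 σ (Icc a b) :=
    (h.smooth_section.of_le (by simp)).comp hγ hU
  set f : ℝ → ℝ := fun t => (Ξ (σ t) (mfderivWithin 𝓘(ℝ, ℝ) IP σ (Icc a b) t (1 : ℝ))).im
    with hf_def
  have hf : ContinuousOn f (Icc a b) := Complex.continuous_im.comp_continuousOn
    (continuousOn_oneForm_mfderivWithin hΞ.smooth hab hσ)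
  -- `f` is controlled only on `[a, b]`. Its constant extension is continuous on `ℝ`, so its
  -- primitive is `C¹` everywhere.
  set g : ℝ → ℝ := IccExtend hab.le ((Icc a b).domRestrict f) with hg_def
  have hg : Continuous g := (continuousOn_iff_continuous_domRestrict.1 hf).Icc_extend'
  have hgf : ∀ t ∈ Icc a b, g t = f t := fun t ht =>
    IccExtend_of_mem hab.le _ ht
  -- Horizontality of `exp(iθ) • σ` reads `iθ' + Ξ(σ') = 0`, hence the integrand. The initial value
  -- makes the lift start at `κ y • s (γ a) = y`.
  set θ : ℝ → ℝ := fun t => Complex.arg (κ y : ℂ) - ∫ r in a..t, g r with hθ_def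
  have hθ : ∀ t, HasDerivAt θ (-g t) t := fun t => by
    simpa [hθ_def] using (hg.integral_hasStrictDerivAt a t).hasDerivAt.const_sub _
  have hθ1 : ContDiff ℝ 1 θ := by
    rw [contDiff_one_iff_deriv]
    refine ⟨fun t => (hθ t).differentiableAt, ?_⟩
    rw [show deriv θ = fun t => -g t from funext fun t => (hθ t).deriv]
    exact hg.neg
  have hexp : ContMDiff 𝓘(ℝ, ℝ) (𝓡 1) 1 fun t => Circle.exp (θ t) :=
    contMDiff_circleExp.comp hθ1.contMDiff
  refine ⟨fun t => Circle.exp (θ t) • σ t, ⟨?_, fun t ht => ?_⟩, ?_, fun t ht => ?_⟩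
  · exact (hp.smooth_smul.of_le (by simp)).comp_contMDiffOn (hexp.contMDiffOn.prodMk hσ)
  · have ht' : t ∈ Icc a b := ⟨ht.1, ht.2.le⟩
    refine (hΞ.apply_mfderivWithin_circleExp_smul hp.smooth_smul (hθ t).hasDerivWithinAt
      (hσ.mdifferentiableOn (by simp) t ht') (uniqueDiffOn_Icc hab t ht')).trans ?_
    rw [hgf t ht']
    have him := hΞ.imaginary (σ t) (mfderivWithin 𝓘(ℝ, ℝ) IP σ (Icc a b) t (1 : ℝ))
    refine Complex.ext ?_ ?_
    · simpa using him
    · simp [hf_def]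
  · have hya : p y ∈ U := hy ▸ hU a (left_mem_Icc.2 hab.le)
    have h1 : Circle.exp (θ a) = κ y := by simp [hθ_def, Circle.exp_arg]
    change Circle.exp (θ a) • s (γ a) = y
    rw [h1, ← hy, h.gauge_smul_section y hya]
  · rw [hp.proj_smul]
    exact h.proj_section _ (hU t ht)

/-- The initial segment of `γ` up to `b` has a horizontal lift starting at `y`. -/
def HasHorizontalLiftUpTo (p : P → M) (Ξ : OneForm IP P) (γ : ℝ → M) (y : P) (b : ℝ) : Prop :=
  ∃ c, IsPiecewiseHorizontal Ξ c b ∧ c 0 = y ∧ ∀ t ∈ Icc 0 b, p (c t) = γ t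

theorem HasHorizontalLiftUpTo.extend_of_gauge (hp : IsPrincipalBundle (𝓡 1) IP IM Circle p)
    (hΞ : IsConnectionForm Ξ) {y : P} (h : HasHorizontalLiftUpTo p Ξ γ y a) {U : Set M}
    {s : M → P} {κ : P → Circle} (hs : IsLocalGauge (𝓡 1) IP IM p U s κ) (ha : 0 ≤ a)
    (hab : a ≤ b) (hγ : ContMDiffOn 𝓘(ℝ, ℝ) IM 1 γ (Icc a b)) (hU : ∀ t ∈ Icc a b, γ t ∈ U) :
    HasHorizontalLiftUpTo p Ξ γ y b := by
  rcases hab.eq_or_lt with rfl | hab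
  · exact h
  obtain ⟨c, hc, hc0, hcγ⟩ := h
  obtain ⟨d, hd, hda, hdγ⟩ := hΞ.exists_isHorizontalOn hp hs hab hγ hU
    (hcγ a (right_mem_Icc.2 ha))
  refine ⟨_, hc.append hd hab.le hda.symm, by simpa [ha] using hc0, fun t ht => ?_⟩
  split_ifs with hta
  · exact hcγ t ⟨ht.1, hta⟩
  · exact hdγ t ⟨(not_le.1 hta).le, ht.2⟩

/-- By compactness `[a, b]` splits into finitely many intervals, each mapped by `γ` into one gauge
domain. -/
theorem HasHorizontalLiftUpTo.extend (hp : IsPrincipalBundle (𝓡 1) IP IM Circle p)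
    (hΞ : IsConnectionForm Ξ) {y : P} (h : HasHorizontalLiftUpTo p Ξ γ y a) (ha : 0 ≤ a)
    (hab : a ≤ b) (hγ : ContMDiffOn 𝓘(ℝ, ℝ) IM 1 γ (Icc a b)) :
    HasHorizontalLiftUpTo p Ξ γ y b := by
  choose U s κ hU hs using hp.exists_localGauge
  have hcont : Continuous fun t : Icc a b => γ t := continuousOn_iff_continuous_domRestrict.1
    hγ.continuousOn
  obtain ⟨t, ht0, ht, ⟨m, hm⟩, hcov⟩ := exists_monotone_Icc_subset_open_cover_Icc hab
    (c := fun m : M => (fun t : Icc a b => γ t) ⁻¹' U m)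
    (fun m => (hs m).isOpen.preimage hcont) fun x _ => mem_iUnion.2 ⟨γ x, hU _⟩
  suffices ∀ k, HasHorizontalLiftUpTo p Ξ γ y (t k) by
    simpa [hm m le_rfl] using this m
  intro k
  induction k with
  | zero => simpa [ht0] using h
  | succ k ih =>
    obtain ⟨m, hm⟩ := hcov k
    refine ih.extend_of_gauge hp hΞ (hs m) (ha.trans (t k).2.1) (ht k.le_succ)
      (hγ.mono (Icc_subset_Icc (t k).2.1 (t (k + 1)).2.2)) fun x hx => ?_
    exact hm (show (⟨x, (t k).2.1.trans hx.1, hx.2.trans (t (k + 1)).2.2⟩ : Icc a b) ∈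
      Icc (t k) (t (k + 1)) from ⟨hx.1, hx.2⟩)

/-- Existence of horizontal lifts. -/
theorem IsConnectionForm.exists_lift (hp : IsPrincipalBundle (𝓡 1) IP IM Circle p)
    (hΞ : IsConnectionForm Ξ) (hγ : IsPiecewiseC1 IM γ) {y : P} (hy : p y = γ 0) :
    ∃ c, IsPiecewiseHorizontal Ξ c 1 ∧ c 0 = y ∧ ∀ t ∈ Icc (0 : ℝ) 1, p (c t) = γ t := by
  obtain ⟨n, t, h0, h1, ht, h⟩ := hγ
  suffices ∀ k ≤ n, HasHorizontalLiftUpTo p Ξ γ y (t k) from h1 ▸ this n le_rfl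
  intro k
  induction k with
  | zero =>
    refine fun _ => ⟨fun _ => y, ⟨0, fun _ => 0, rfl, h0.symm, monotone_const, by simp⟩, rfl,
      fun x hx => ?_⟩
    rw [h0] at hx
    rwa [le_antisymm hx.2 hx.1]
  | succ k ih =>
    exact fun hk => (ih (by omega)).extend hp hΞ (h0 ▸ ht (Nat.zero_le k)) (ht k.le_succ)
      (h k (by omega))

end ParallelTransport

/-! ### Uniqueness of lifts and holonomy -/

section Holonomy

variable {EP : Type*} [NormedAddCommGroup EP] [NormedSpace ℝ EP]
  {HP : Type*} [TopologicalSpace HP] {IP : ModelWithCorners ℝ EP HP}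
  {P : Type*} [TopologicalSpace P] [ChartedSpace HP P] [IsManifold IP 1 P]
  {EM : Type*} [NormedAddCommGroup EM] [NormedSpace ℝ EM]
  {HM : Type*} [TopologicalSpace HM] {IM : ModelWithCorners ℝ EM HM}
  {M : Type*} [TopologicalSpace M] [ChartedSpace HM M]
  [MulAction Circle P] {p : P → M} {Ξ : OneForm IP P} {γ : ℝ → M}

/-- If `c` and `x ↦ u x • c x` are both horizontal at `t`, then the derivative of `u` vanishes
at `t`. -/
theorem IsConnectionForm.hasDerivAt_zero_of_horizontal
    (hsmul : ContMDiff ((𝓡 1).prod IP) IP ∞ (fun x : Circle × P => x.1 • x.2))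
    (hΞ : IsConnectionForm Ξ) {c c' : ℝ → P} {u : ℝ → Circle} {t : ℝ}
    (hu : DifferentiableAt ℝ (fun x => (u x : ℂ)) t)
    (hc : MDifferentiableAt 𝓘(ℝ, ℝ) IP c t) (hcu : ∀ᶠ x in nhds t, c' x = u x • c x)
    (h : Ξ (c t) (mfderiv 𝓘(ℝ, ℝ) IP c t (1 : ℝ)) = 0)
    (h' : Ξ (c' t) (mfderiv 𝓘(ℝ, ℝ) IP c' t (1 : ℝ)) = 0) :
    HasDerivAt (fun x => (u x : ℂ)) 0 t := by
  -- Division by `u t` moves the value at `t` to `1`, away from the branch cut of the argument.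
  set θ : ℝ → ℝ := fun x => Complex.arg ((u x * (u t)⁻¹ : Circle) : ℂ) with hθ_def
  have hθ : DifferentiableAt ℝ θ t := by
    have h1 : DifferentiableAt ℝ (fun x => Complex.log ((u x * (u t)⁻¹ : Circle) : ℂ)) t := by
      have h0 : ((u t * (u t)⁻¹ : Circle) : ℂ) ∈ Complex.slitPlane := by
        rw [mul_inv_cancel, Circle.coe_one]
        exact Complex.one_mem_slitPlane
      have h2 : DifferentiableAt ℝ (fun x => ((u x * (u t)⁻¹ : Circle) : ℂ)) t := by
        simpa only [Circle.coe_mul] using hu.mul_const (((u t)⁻¹ : Circle) : ℂ)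
      exact (h2.hasDerivAt.clog_real h0).differentiableAt
    simpa [hθ_def, Complex.log_im, Function.comp_def] using
      (Complex.imCLM.differentiableAt (x := Complex.log ((u t * (u t)⁻¹ : Circle) : ℂ))).comp t h1
  have hexp : ∀ x, Circle.exp (θ x) = u x * (u t)⁻¹ := fun x => Circle.exp_arg _
  have hb : MDifferentiableAt 𝓘(ℝ, ℝ) IP (fun x => u t • c x) t :=
    (mdifferentiable_smul_left hsmul (u t) (c t)).comp t hc
  have hc' : c' =ᶠ[nhds t] fun x => Circle.exp (θ x) • u t • c x := by
    filter_upwards [hcu] with x hx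
    rw [hexp, hx, smul_smul, inv_mul_cancel_right]
  have key := hΞ.apply_mfderivWithin_circleExp_smul hsmul (s := univ)
    hθ.hasDerivAt.hasDerivWithinAt hb.mdifferentiableWithinAt uniqueDiffWithinAt_univ
  simp only [mfderivWithin_univ] at key
  have h1 := mfderiv_comp_apply t (mdifferentiable_smul_left hsmul (u t) (c t)) hc (1 : ℝ)
  have h2 : Ξ (u t • c t) (mfderiv 𝓘(ℝ, ℝ) IP (fun x => u t • c x) t (1 : ℝ)) = 0 :=
    (congrArg (Ξ (u t • c t)) h1).trans ((hΞ.invariant (u t) (c t) _).trans h)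
  rw [h2, add_zero, ← hc'.mfderiv_eq] at key
  have h3 := (OneForm.apply_congr Ξ hc'.eq_of_nhds _).symm.trans h'
  have h4 : deriv θ t = 0 := by
    have := key.symm.trans h3
    simpa using this
  have h5 : HasDerivAt θ 0 t := h4 ▸ hθ.hasDerivAt
  have h6 : (fun x => (u x : ℂ)) = fun x => Complex.exp (θ x * Complex.I) * u t := by
    funext x
    rw [← Circle.coe_exp, hexp, ← Circle.coe_mul, inv_mul_cancel_right]
  rw [h6]
  simpa using ((h5.ofReal_comp.mul_const Complex.I).cexp.mul_const (u t : ℂ))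

/-- Horizontal lifts of the same curve differ by a constant element of `U(1)`. -/
theorem IsConnectionForm.lift_unique (hp : IsPrincipalBundle (𝓡 1) IP IM Circle p)
    (hΞ : IsConnectionForm Ξ) {c c' : ℝ → P} (hc : IsHorizontalLift p Ξ γ c)
    (hc' : IsHorizontalLift p Ξ γ c') {v : Circle} (hv : c' 0 = v • c 0) : c' 1 = v • c 1 := by
  -- The ratio `u` of the two lifts is chosen pointwise, with a dummy value off `[0, 1]`. Its
  -- regularity comes from the local formula in `hgauge`.
  have hex : ∀ t : ℝ, ∃ u : Circle, t ∈ Icc (0 : ℝ) 1 → u • c t = c' t := fun t => by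
    by_cases ht : t ∈ Icc (0 : ℝ) 1
    · obtain ⟨u, hu⟩ := hp.exists_smul_eq ((hc.lift t ht).trans (hc'.lift t ht).symm)
      exact ⟨u, fun _ => hu⟩
    · exact ⟨1, fun h => absurd h ht⟩
  choose u hu using hex
  have hgauge : ∀ t ∈ Icc (0 : ℝ) 1, ∃ κ : P → Circle,
      ContMDiffAt IP (𝓡 1) ∞ κ (c t) ∧ ContMDiffAt IP (𝓡 1) ∞ κ (c' t) ∧
        ∀ᶠ x in nhdsWithin t (Icc 0 1), u x = κ (c' x) * (κ (c x))⁻¹ := fun t ht => by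
    obtain ⟨U, s, κ, hU, h⟩ := hp.exists_localGauge (γ t)
    have hO : IsOpen (p ⁻¹' U) := h.isOpen.preimage hp.contMDiff_proj.continuous
    have h1 : c t ∈ p ⁻¹' U := by rw [mem_preimage, hc.lift t ht]; exact hU
    have h2 : c' t ∈ p ⁻¹' U := by rw [mem_preimage, hc'.lift t ht]; exact hU
    refine ⟨κ, h.smooth_gauge.contMDiffAt (hO.mem_nhds h1),
      h.smooth_gauge.contMDiffAt (hO.mem_nhds h2), ?_⟩
    filter_upwards [(hc.piecewiseC1.continuousOn t ht).preimage_mem_nhdsWithin (hO.mem_nhds h1),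
      self_mem_nhdsWithin] with x hx hx'
    rw [← hu x hx', h.gauge_smul _ _ hx, mul_inv_cancel_right]
  have hcont : ContinuousOn (fun x => (u x : ℂ)) (Icc 0 1) := fun t ht => by
    obtain ⟨κ, h1, h2, h3⟩ := hgauge t ht
    have h4 : ContinuousWithinAt (fun x => κ (c' x) * (κ (c x))⁻¹) (Icc 0 1) t :=
      (h2.continuousAt.comp_continuousWithinAt (hc'.piecewiseC1.continuousOn t ht)).mul
        (h1.continuousAt.comp_continuousWithinAt (hc.piecewiseC1.continuousOn t ht)).inv
    exact (continuous_subtype_val (p := fun z : ℂ => z ∈ Submonoid.unitSphere ℂ)).continuousAt.comp_continuousWithinAt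
      (h4.congr_of_eventuallyEq h3 (h3.self_of_nhdsWithin ht))
  obtain ⟨S, hS, hSc⟩ := hc.piecewiseC1.exists_countable_mdifferentiableAt
  obtain ⟨S', hS', hSc'⟩ := hc'.piecewiseC1.exists_countable_mdifferentiableAt
  have hderiv : ∀ t ∈ Ioo (0 : ℝ) 1 \ (S ∪ S'), HasDerivAt (fun x => (u x : ℂ)) 0 t := by
    intro t ht
    have htI : t ∈ Icc (0 : ℝ) 1 := Ioo_subset_Icc_self ht.1
    have hnhds : Icc (0 : ℝ) 1 ∈ nhds t := Icc_mem_nhds ht.1.1 ht.1.2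
    have hd := hSc t ⟨ht.1, fun h => ht.2 (Or.inl h)⟩
    have hd' := hSc' t ⟨ht.1, fun h => ht.2 (Or.inr h)⟩
    obtain ⟨κ, h1, h2, h3⟩ := hgauge t htI
    rw [nhdsWithin_eq_nhds.2 hnhds] at h3
    have hcoe : ContMDiff (𝓡 1) 𝓘(ℝ, ℂ) ∞ (fun z : Circle => (z : ℂ)) := by
      have : Fact (Module.finrank ℝ ℂ = 1 + 1) := finrank_real_complex_fact'
      exact contMDiff_coe_sphere
    have hdiff : ∀ {κ : P → Circle} {d : ℝ → P}, ContMDiffAt IP (𝓡 1) ∞ κ (d t) →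
        MDifferentiableAt 𝓘(ℝ, ℝ) IP d t → DifferentiableAt ℝ (fun x => (κ (d x) : ℂ)) t :=
      fun hκ hd => (((hcoe.contMDiffAt.comp _ hκ).mdifferentiableAt (by simp)).comp t
        hd).differentiableAt
    have hudiff : DifferentiableAt ℝ (fun x => (u x : ℂ)) t := by
      refine ((hdiff h2 hd').mul ((hdiff h1 hd).inv (Circle.coe_ne_zero _))).congr_of_eventuallyEq
        ?_
      filter_upwards [h3] with x hx
      simp [hx]
    refine hΞ.hasDerivAt_zero_of_horizontal hp.smooth_smul hudiff hd ?_
      (hc.horizontal t ht.1 hd) (hc'.horizontal t ht.1 hd')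
    filter_upwards [hnhds] with x hx using (hu x hx).symm
  -- A continuous function whose derivative vanishes off a countable set has equal values at the
  -- endpoints, so breakpoints do no harm.
  have hint := MeasureTheory.integral_eq_of_hasDerivAt_off_countable_of_le
    (fun x => (u x : ℂ)) (fun _ => 0) zero_le_one (hS.union hS') hcont hderiv
    intervalIntegrable_const
  have hu01 : u 1 = u 0 := Circle.ext (by
    rw [intervalIntegral.integral_zero] at hint
    exact sub_eq_zero.1 hint.symm)
  have hu0 : u 0 = v := hp.smul_left_injective (c 0) ((hu 0 (by simp)).trans hv)
  rw [← hu 1 (by simp), hu01, hu0]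

/-- One lift decides: any other is `v • c` at both ends for a single `v`, which commutes with `u`
because `U(1)` is abelian, and with `φ` by hypothesis. -/
theorem IsConnectionForm.isEquivariantHolonomy_iff {G : Type*} [Group G] [MulAction G P]
    [SMulCommClass G Circle P] (hp : IsPrincipalBundle (𝓡 1) IP IM Circle p)
    (hΞ : IsConnectionForm Ξ) (hγ : IsPiecewiseC1 IM γ) {φ : G} {c : ℝ → P}
    (hc : IsHorizontalLift p Ξ γ c) {u : Circle} :
    IsEquivariantHolonomy p Ξ φ γ u ↔ c 1 = u • φ • c 0 := by
  refine ⟨fun h => h.2 c hc, fun h => ⟨fun y hy => ?_, fun c' hc' => ?_⟩⟩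
  · obtain ⟨d, hd, hd0, hdγ⟩ := hΞ.exists_lift hp hγ hy
    exact ⟨d, hd.isHorizontalLift hdγ, hd0⟩
  · obtain ⟨v, hv⟩ := hp.exists_smul_eq
      ((hc.lift 0 (by simp)).trans (hc'.lift 0 (by simp)).symm)
    rw [hΞ.lift_unique hp hc hc' hv.symm, h, ← hv, smul_comm φ v, smul_comm v u]

theorem IsConnectionForm.isHolonomy_iff (hp : IsPrincipalBundle (𝓡 1) IP IM Circle p)
    (hΞ : IsConnectionForm Ξ) (hγ : IsPiecewiseC1 IM γ) {c : ℝ → P}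
    (hc : IsHorizontalLift p Ξ γ c) {u : Circle} :
    IsHolonomy p Ξ γ u ↔ c 1 = u • c 0 := by
  -- Ordinary holonomy is the equivariant one for `φ = 1`. The abelian group `Circle` itself serves
  -- as `G`.
  simpa [IsHolonomy, IsEquivariantHolonomy] using
    hΞ.isEquivariantHolonomy_iff hp hγ (φ := (1 : Circle)) hc (u := u)

end Holonomy

/-! ### The main theorem -/

theorem mainTheorem8
    -- the Lie group `G`
    {EG : Type*} [NormedAddCommGroup EG] [NormedSpace ℝ EG] [FiniteDimensional ℝ EG]
    {G : Type*} [Group G] [TopologicalSpace G] [ChartedSpace EG G] [LieGroup 𝓘(ℝ, EG) ∞ G]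
    -- the manifolds `M` and `P`
    {EM : Type*} [NormedAddCommGroup EM] [NormedSpace ℝ EM] [FiniteDimensional ℝ EM]
    {M : Type*} [TopologicalSpace M] [ChartedSpace EM M] [IsManifold 𝓘(ℝ, EM) ∞ M]
    {EP : Type*} [NormedAddCommGroup EP] [NormedSpace ℝ EP] [FiniteDimensional ℝ EP]
    {P : Type*} [TopologicalSpace P] [ChartedSpace EP P] [IsManifold 𝓘(ℝ, EP) ∞ P]
    -- `p : P → M` is a `G`-equivariant principal `U(1)`-bundle
    [MulAction Circle P] [MulAction G M] [MulAction G P] [SMulCommClass G Circle P]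
    (p : P → M)
    (hp : IsPrincipalBundle (𝓡 1) 𝓘(ℝ, EP) 𝓘(ℝ, EM) Circle p)
    (hpG : ∀ (g : G) (y : P), p (g • y) = g • p y)
    -- `P/G` and `M/G` are manifolds such that `P → P/G` and `M → M/G` are principal `G`-bundles
    {EPG : Type*} [NormedAddCommGroup EPG] [NormedSpace ℝ EPG] [FiniteDimensional ℝ EPG]
    [ChartedSpace EPG (orbitRel.Quotient G P)] [IsManifold 𝓘(ℝ, EPG) ∞ (orbitRel.Quotient G P)]
    {EMG : Type*} [NormedAddCommGroup EMG] [NormedSpace ℝ EMG] [FiniteDimensional ℝ EMG]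
    [ChartedSpace EMG (orbitRel.Quotient G M)] [IsManifold 𝓘(ℝ, EMG) ∞ (orbitRel.Quotient G M)]
    (hqP : IsPrincipalBundle 𝓘(ℝ, EG) 𝓘(ℝ, EP) 𝓘(ℝ, EPG) G (quotientProj G P))
    (hqM : IsPrincipalBundle 𝓘(ℝ, EG) 𝓘(ℝ, EM) 𝓘(ℝ, EMG) G (quotientProj G M))
    -- `Ξ` is a `G`-invariant connection on `P → M` with vanishing momentum
    (Ξ : OneForm 𝓘(ℝ, EP) P) (hΞ : IsConnectionForm Ξ) (hΞG : IsInvariantForm G Ξ)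
    (hμ : ∀ (X : GroupLieAlgebra 𝓘(ℝ, EG) G) (y : P), momentum 𝓘(ℝ, EG) Ξ X y = 0) :
    -- `P/G → M/G` is a principal `U(1)`-bundle
    IsPrincipalBundle (𝓡 1) 𝓘(ℝ, EPG) 𝓘(ℝ, EMG) Circle (quotientMap p hpG) ∧
    -- `Ξ` is the pull-back of a unique form `Ξ'` on `P/G`, which is a connection on `P/G → M/G`
    ∃ Ξ' : OneForm 𝓘(ℝ, EPG) (orbitRel.Quotient G P),
      IsConnectionForm Ξ' ∧
      (∀ Ξ'' : OneForm 𝓘(ℝ, EPG) (orbitRel.Quotient G P),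
        (∀ (y : P) (v : TangentSpace 𝓘(ℝ, EP) y),
          Ξ'' (quotientProj G P y) (mfderiv 𝓘(ℝ, EP) 𝓘(ℝ, EPG) (quotientProj G P) y v) = Ξ y v) ↔
        Ξ'' = Ξ') ∧
      -- the holonomies exist, are unique, and agree
      ∀ (φ : G), ∀ γ ∈ twistedLoopSpace 𝓘(ℝ, EM) M φ,
        quotientProj G M ∘ γ ∈ loopSpace 𝓘(ℝ, EMG) (orbitRel.Quotient G M) ∧
        (∃! u : Circle, IsEquivariantHolonomy p Ξ φ γ u) ∧
        (∃! u : Circle, IsHolonomy (quotientMap p hpG) Ξ' (quotientProj G M ∘ γ) u) ∧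
        equivariantHolonomy p Ξ φ γ =
          holonomy (quotientMap p hpG) Ξ' (quotientProj G M ∘ γ) := by
  have hΞv : ∀ (X : GroupLieAlgebra 𝓘(ℝ, EG) G) (y : P),
      Ξ _ (fundamentalField 𝓘(ℝ, EP) 𝓘(ℝ, EG) X y) = 0 := fun X y =>
    (mul_eq_zero.1 (hμ X y)).resolve_left (neg_ne_zero.2 (div_ne_zero Complex.I_ne_zero
      (mul_ne_zero two_ne_zero (Complex.ofReal_ne_zero.2 Real.pi_ne_zero))))
  have hpQ := hp.quotientMap hpG hqP hqM
  obtain ⟨Ξ', hΞ'⟩ := hΞG.exists_descent hqP hΞv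
  have hconn : IsConnectionForm Ξ' := hΞ.of_pullback hqP (fun _ _ => rfl) hp.smooth_smul
    hpQ.smooth_smul hΞ'
  refine ⟨hpQ, Ξ', hconn, fun Ξ'' => ⟨fun h => hqP.oneForm_ext fun y v =>
    (h y v).trans (hΞ' y v).symm, fun h => h ▸ hΞ'⟩, fun φ γ hγ => ?_⟩
  have hqγ : IsPiecewiseC1 𝓘(ℝ, EMG) (quotientProj G M ∘ γ) := hγ.1.comp hqM.contMDiff_proj
  obtain ⟨y, hy⟩ := hp.surjective (γ 0)
  obtain ⟨c, hc, -, hcγ⟩ := hΞ.exists_lift hp hγ.1 hy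
  have hlift : IsHorizontalLift p Ξ γ c := hc.isHorizontalLift hcγ
  -- The same curve `c` serves upstairs and, after projection, downstairs.
  have hlift' : IsHorizontalLift (quotientMap p hpG) Ξ' (quotientProj G M ∘ γ)
      (quotientProj G P ∘ c) := (hc.map hqP.contMDiff_proj hΞ').isHorizontalLift fun t ht =>
    congrArg (quotientProj G M) (hcγ t ht)
  obtain ⟨u, hu⟩ : ∃ u : Circle, u • φ • c 0 = c 1 := hp.exists_smul_eq (by
    rw [hpG, hcγ 0 (by simp), hcγ 1 (by simp), hγ.2])
  have hE : IsEquivariantHolonomy p Ξ φ γ u :=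
    (hΞ.isEquivariantHolonomy_iff hp hγ.1 hlift).2 hu.symm
  have hH : IsHolonomy (quotientMap p hpG) Ξ' (quotientProj G M ∘ γ) u := by
    refine (hconn.isHolonomy_iff hpQ hqγ hlift').2 ?_
    simp only [Function.comp_apply]
    -- The projection to `P/G` commutes with `u` and absorbs `φ`.
    rw [← hu, quotientProj_smul, quotientProj_smul_self]
  have hEu : ∀ v, IsEquivariantHolonomy p Ξ φ γ v → v = u := fun v hv =>
    hp.smul_left_injective (φ • c 0) ((hv.2 c hlift).symm.trans (hE.2 c hlift))
  have hHu : ∀ v, IsHolonomy (quotientMap p hpG) Ξ' (quotientProj G M ∘ γ) v → v = u := fun v hv =>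
    hpQ.smul_left_injective _ ((hv.2 _ hlift').symm.trans (hH.2 _ hlift'))
  refine ⟨⟨hqγ, ?_⟩, ⟨u, hE, hEu⟩, ⟨u, hH, hHu⟩, ?_⟩
  · simp only [Function.comp_apply]
    rw [hγ.2, quotientProj_smul_self]
  · exact (hEu _ (Classical.epsilon_spec ⟨u, hE⟩)).trans
      (hHu _ (Classical.epsilon_spec ⟨u, hH⟩)).symm
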